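/- Let $f$ be a field of characteristic $p\ge 0$, and let $F=f((t))$ be the field of formal Laurent series with its usual $t$-adic topology ($f$ being discrete). Let $n\ge 0$ be an integer and let $G_n$ be the group of those field automorphisms $g$ of $F$ over $f$ that satisfy $g(t)=t+o(t^n)$, i.e. $g(t)-t\in t^{n+1}f[[t]]$ (for $n=0$ these are all automorphisms of $F$ over $f$). For an integer $q\ge 0$ let $f((t^q))\subseteq F$ be the set of series in which only exponents divisible by $q$ occur; in particular $f((t^0))=f$ and, with $0^0=1$, $f((t^{p^0}))=F$ also for $p=0$. Denote by $G_n(h)$ the orbit of $h\in F$, and give the orbit space $F/G_n$ the quotient topology. Then: 1. For every $h\in F$, the orbit $G_n(h)$ is open in $F$ if and only if $h\notin f((t^p))$. 2. The statement "for every $h\in F\setminus f$ and every integer $m\ge 0$ with $h\in f((t^{p^m}))\setminus f((t^{p^{m+1}}))$, the orbit $G_n(h)$ is open in the relative topology of $f((t^{p^m}))$" is true if and only if $f$ is perfect. 3. Every $h\in F\setminus f((t^p))$ has a polynomial normal form, i.e. $G_n(h)\cap f[t^{-1},t]\neq\emptyset$. 4. Every $h\in F$ has a polynomial normal form if and only if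 $f$ is perfect. 5. Every $G_n$-orbit in $F$ is closed. 6. The canonical projection $\beta:F\to F/G_n$, $h\mapsto G_n(h)$, is a closed map if and only if $f$ is finite or $p=0$. 7. The topology of the orbit space $F/G_n$ is induced by a complete metric. -/

import Mathlib

open scoped LaurentSeries

namespace FormalSing

variable {f : Type*} [Field f]

/-- The variable `t` of the field `f((t))` of formal Laurent series. -/
noncomputable def tvar (f : Type*) [Field f] : f⸨X⸩ := HahnSeries.single (1 : ℤ) (1 : f)

/-- A Laurent series of nonnegative order is a power series. -/
theorem exists_powerSeries {h : f⸨X⸩} (hh : 0 ≤ h.orderTop) :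
    ∃ P : PowerSeries f, h = (P : f⸨X⸩) := by
  have h1 : ∀ n : ℤ, n < 0 → h.coeff n = 0 := fun n hn =>
    HahnSeries.coeff_eq_zero_of_lt_orderTop (lt_of_lt_of_le (by exact_mod_cast hn) hh)
  have h2 := (LaurentSeries.valuation_le_iff_coeff_lt_eq_zero f (D := 0) (f := h)).2 h1
  obtain ⟨P, hP⟩ := (LaurentSeries.val_le_one_iff_eq_coe f h).1 (by simpa using h2)
  exact ⟨P, hP.symm⟩

theorem orderTop_powerSeries (P : PowerSeries f) : 0 ≤ (P : f⸨X⸩).orderTop := by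
  rw [HahnSeries.le_orderTop_iff_forall]
  intro j hj
  have hj' : j < 0 := by exact_mod_cast hj
  rw [PowerSeries.coeff_coe]
  simp [hj']

/-- Every series `x` of positive order can be written as `y ^ 2 + y` with `y` of positive order. -/
theorem exists_sq_add_self {x : f⸨X⸩} (hx : 0 < x.orderTop) :
    ∃ y : f⸨X⸩, 0 < y.orderTop ∧ y * (y + 1) = x := by
  obtain ⟨P, rfl⟩ := exists_powerSeries hx.le
  have hI : P ∈ (Ideal.span {(PowerSeries.X : PowerSeries f)}) := by
    rw [Ideal.mem_span_singleton, PowerSeries.X_dvd_iff]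
    have := HahnSeries.coeff_eq_zero_of_lt_orderTop (x := (P : f⸨X⸩)) (i := 0) (by exact_mod_cast hx)
    rw [PowerSeries.coeff_coe] at this
    simpa using this
  have hdeg : ((Polynomial.X - Polynomial.C P : Polynomial (PowerSeries f))).degree < (2 : ℕ) := by
    rw [Polynomial.degree_X_sub_C]; norm_num
  obtain ⟨a, ha, ha'⟩ := HenselianRing.is_henselian
    (I := Ideal.span {(PowerSeries.X : PowerSeries f)})
    (Polynomial.X ^ 2 + (Polynomial.X - Polynomial.C P)) (Polynomial.monic_X_pow_add hdeg) 0
    (by simpa using hI) (by simp)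
  have e : a ^ 2 + (a - P) = 0 := by simpa [Polynomial.IsRoot] using ha
  refine ⟨(a : f⸨X⸩), ?_, ?_⟩
  · have ha2 : PowerSeries.constantCoeff a = 0 := by
      rw [sub_zero, Ideal.mem_span_singleton, PowerSeries.X_dvd_iff] at ha'
      exact ha'
    refine lt_of_le_of_ne (orderTop_powerSeries a) fun h0 => ?_
    refine HahnSeries.coeff_orderTop_ne (x := (a : f⸨X⸩)) (g := 0) h0.symm ?_
    rw [PowerSeries.coeff_coe]
    simpa using ha2
  · have : P = a * (a + 1) := by linear_combination -e
    rw [this]; push_cast; simp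

/-- A field automorphism over `f` maps series of positive order to power series. -/
theorem map_nonneg_of_pos (g : f⸨X⸩ ≃ₐ[f] f⸨X⸩) {x : f⸨X⸩} (hx : 0 < x.orderTop) :
    0 ≤ (g x).orderTop := by
  have key : ∀ N : ℕ, ∀ x : f⸨X⸩, 0 < x.orderTop → (g x).orderTop ≠ ((-(N + 1 : ℕ) : ℤ) : WithTop ℤ) := by
    intro N
    induction N using Nat.strong_induction_on with
    | _ N ih =>
      intro x hx hN
      obtain ⟨y, hy, rfl⟩ := exists_sq_add_self hx
      have hneg : (g y).orderTop < 0 := by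
        by_contra! hge
        have h1 : 0 ≤ (g y + 1).orderTop := by
          refine le_trans ?_ HahnSeries.min_orderTop_le_orderTop_add
          simp [HahnSeries.orderTop_one, hge]
        have h2 : 0 ≤ (g y).orderTop + (g y + 1).orderTop := add_nonneg hge h1
        rw [map_mul, map_add, map_one, HahnSeries.orderTop_mul] at hN
        rw [hN] at h2
        have : (0 : ℤ) ≤ -(N + 1 : ℕ) := by exact_mod_cast h2
        omega
      have hadd : (g y + 1).orderTop = (g y).orderTop :=
        HahnSeries.orderTop_add_eq_left (by simpa [HahnSeries.orderTop_one] using hneg)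
      rw [map_mul, map_add, map_one, HahnSeries.orderTop_mul, hadd] at hN
      obtain ⟨k, hk⟩ := WithTop.ne_top_iff_exists.1 (ne_top_of_lt hneg)
      rw [← hk] at hN hneg
      have hk0 : k < 0 := by exact_mod_cast hneg
      have hkN : k + k = -(N + 1 : ℕ) := by exact_mod_cast hN
      obtain ⟨M, hM⟩ : ∃ M : ℕ, k = -(M + 1 : ℕ) := ⟨(-k - 1).toNat, by omega⟩
      exact ih M (by omega) y hy (by rw [← hk, hM])
  by_contra! hlt
  obtain ⟨k, hk⟩ := WithTop.ne_top_iff_exists.1 (ne_top_of_lt hlt)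
  rw [← hk] at hlt
  have hk0 : k < 0 := by exact_mod_cast hlt
  obtain ⟨M, hM⟩ : ∃ M : ℕ, k = -(M + 1 : ℕ) := ⟨(-k - 1).toNat, by omega⟩
  exact key M x hx (by rw [← hk, hM])

theorem map_C (g : f⸨X⸩ ≃ₐ[f] f⸨X⸩) (c : f) : g (HahnSeries.C c) = HahnSeries.C c := by
  have := g.commutes c
  rwa [LaurentSeries.algebraMap_apply] at this

theorem C_nonneg (c : f) : 0 ≤ (HahnSeries.C c : f⸨X⸩).orderTop := by
  rw [← PowerSeries.coe_C]; exact orderTop_powerSeries _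

theorem sub_C_pos {h : f⸨X⸩} (hh : 0 ≤ h.orderTop) :
    0 < (h - HahnSeries.C (h.coeff 0)).orderTop := by
  have h1 : 0 ≤ (h - HahnSeries.C (h.coeff 0)).orderTop :=
    le_trans (le_min hh (C_nonneg _)) HahnSeries.min_orderTop_le_orderTop_sub
  refine lt_of_le_of_ne h1 fun h0 => ?_
  refine HahnSeries.coeff_orderTop_ne (g := 0) h0.symm ?_
  simp [HahnSeries.C_apply]

/-- A field automorphism over `f` maps power series to power series. -/
theorem map_nonneg (g : f⸨X⸩ ≃ₐ[f] f⸨X⸩) {h : f⸨X⸩} (hh : 0 ≤ h.orderTop) :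
    0 ≤ (g h).orderTop := by
  have h1 := map_nonneg_of_pos g (sub_C_pos hh)
  have h2 : g h = g (h - HahnSeries.C (h.coeff 0)) + HahnSeries.C (h.coeff 0) := by
    rw [map_sub, map_C]; ring
  rw [h2]
  exact le_trans (le_min h1 (C_nonneg _)) HahnSeries.min_orderTop_le_orderTop_add

/-- A field automorphism over `f` maps series of positive order to series of positive order. -/
theorem map_pos (g : f⸨X⸩ ≃ₐ[f] f⸨X⸩) {x : f⸨X⸩} (hx : 0 < x.orderTop) :
    0 < (g x).orderTop := by
  have h1 := map_nonneg_of_pos g hx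
  have h2 := sub_C_pos h1
  set c := (g x).coeff 0 with hc
  by_cases hc0 : c = 0
  · simpa [hc0] using h2
  exfalso
  -- the series `x - c` is invertible in `f[[t]]`, while its image has positive order
  have hsum : (x - HahnSeries.C c).orderTop = 0 := by
    have e : (HahnSeries.C c : f⸨X⸩).orderTop = 0 := by
      rw [HahnSeries.C_apply, HahnSeries.orderTop_single hc0]; rfl
    have := HahnSeries.orderTop_add_eq_right (x := x) (y := - HahnSeries.C c)
      (by rw [HahnSeries.orderTop_neg, e]; exact hx)
    rw [sub_eq_add_neg, this, HahnSeries.orderTop_neg, e]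
  have hne : x - HahnSeries.C c ≠ 0 := by
    intro h0; rw [h0, HahnSeries.orderTop_zero] at hsum; exact absurd hsum (by simp)
  have hinv : 0 ≤ ((x - HahnSeries.C c)⁻¹).orderTop := by
    have := HahnSeries.orderTop_mul (x - HahnSeries.C c) (x - HahnSeries.C c)⁻¹
    rw [mul_inv_cancel₀ hne, hsum, zero_add, HahnSeries.orderTop_one] at this
    exact this.le
  have h3 := map_nonneg g hinv
  have h4 := HahnSeries.orderTop_mul (g (x - HahnSeries.C c)) (g (x - HahnSeries.C c)⁻¹)
  rw [← map_mul, mul_inv_cancel₀ hne, map_one, HahnSeries.orderTop_one, map_sub, map_C] at h4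
  exact absurd h4 (ne_of_lt (add_pos_of_pos_of_nonneg h2 h3))

theorem orderTop_tvar : (tvar f).orderTop = ((1 : ℤ) : WithTop ℤ) :=
  HahnSeries.orderTop_single one_ne_zero

/-- A field automorphism over `f` does not decrease orders (of positive-order series). -/
theorem lt_orderTop_map (g : f⸨X⸩ ≃ₐ[f] f⸨X⸩) (n : ℕ) {x : f⸨X⸩}
    (hx : ((n : ℤ) : WithTop ℤ) < x.orderTop) : ((n : ℤ) : WithTop ℤ) < (g x).orderTop := by
  induction n generalizing x with
  | zero => simpa using map_pos g (x := x) (by simpa using hx)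
  | succ n ih =>
    have ht0 : tvar f ≠ 0 := by
      intro h0; have := orderTop_tvar (f := f); rw [h0, HahnSeries.orderTop_zero] at this; simp at this
    obtain ⟨y, rfl⟩ : ∃ y, x = tvar f * y := ⟨(tvar f)⁻¹ * x, by field_simp⟩
    have ht : ((1 : ℤ) : WithTop ℤ) ≤ (g (tvar f)).orderTop := by
      have := map_pos g (x := tvar f) (by rw [orderTop_tvar]; norm_num)
      cases h : (g (tvar f)).orderTop with
      | top => simp
      | coe k => rw [h] at this; norm_cast at this ⊢
    have hy : ((n : ℤ) : WithTop ℤ) < y.orderTop := by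
      rw [HahnSeries.orderTop_mul, orderTop_tvar] at hx
      cases h : y.orderTop with
      | top => exact WithTop.coe_lt_top _
      | coe k => rw [h] at hx; norm_cast at hx ⊢; push_cast at hx; omega
    have h1 := ih hy
    rw [map_mul, HahnSeries.orderTop_mul]
    refine lt_of_lt_of_le ?_ (add_le_add ht le_rfl)
    cases h : (g y).orderTop with
    | top => simp
    | coe k => rw [h] at h1; norm_cast at h1 ⊢; push_cast; omega

/-- `h = o(t ^ n)` in terms of coefficients and in terms of the order. -/
theorem lt_orderTop_iff (n : ℕ) (h : f⸨X⸩) :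
    (∀ i : ℤ, i ≤ n → h.coeff i = 0) ↔ ((n : ℤ) : WithTop ℤ) < h.orderTop := by
  constructor
  · intro H
    by_contra! hle
    obtain ⟨k, hk⟩ := WithTop.ne_top_iff_exists.1 (ne_top_of_le_ne_top WithTop.coe_ne_top hle)
    rw [← hk] at hle
    exact HahnSeries.coeff_orderTop_ne hk.symm (H k (by exact_mod_cast hle))
  · intro H i hi
    exact HahnSeries.coeff_eq_zero_of_lt_orderTop (lt_of_le_of_lt (by exact_mod_cast hi) H)

/-- The group `G_n` of those automorphisms `g` of `f((t))` over `f` that satisfy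
`g(t) = t + o(t ^ n)`, that is, `g(t) - t` has no terms of degree `≤ n`. -/
def G (f : Type*) [Field f] (n : ℕ) : Subgroup (f⸨X⸩ ≃ₐ[f] f⸨X⸩) where
  carrier := {g | ∀ i : ℤ, i ≤ n → (g (tvar f) - tvar f).coeff i = 0}
  one_mem' := by intro i _; simp
  mul_mem' := by
    intro a b ha hb
    simp only [Set.mem_ofPred_eq, lt_orderTop_iff] at ha hb ⊢
    have e : (a * b) (tvar f) - tvar f = a (b (tvar f) - tvar f) + (a (tvar f) - tvar f) := by
      rw [map_sub, AlgEquiv.mul_apply]; ring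
    rw [e]
    exact lt_of_lt_of_le (lt_min (lt_orderTop_map a n hb) ha)
      HahnSeries.min_orderTop_le_orderTop_add
  inv_mem' := by
    intro a ha
    simp only [Set.mem_ofPred_eq, lt_orderTop_iff] at ha ⊢
    have e : a⁻¹ (tvar f) - tvar f = - a⁻¹ (a (tvar f) - tvar f) := by
      rw [map_sub, ← AlgEquiv.mul_apply, inv_mul_cancel, AlgEquiv.one_apply]; ring
    rw [e, HahnSeries.orderTop_neg]
    exact lt_orderTop_map a⁻¹ n ha

/-- `G_0` is the group of all automorphisms of `f((t))` over `f`. -/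
theorem G_zero : G f 0 = ⊤ := by
  refine eq_top_iff.2 fun g _ => ?_
  change ∀ i : ℤ, i ≤ ((0 : ℕ) : ℤ) → _
  rw [lt_orderTop_iff]
  have ht : ((0 : ℕ) : ℤ) < (tvar f).orderTop := by
    rw [orderTop_tvar]; exact_mod_cast (by norm_num : (0 : ℤ) < 1)
  exact lt_of_lt_of_le (lt_min (lt_orderTop_map g 0 ht) ht)
    HahnSeries.min_orderTop_le_orderTop_sub

/-- `f((t ^ q))` as a subset of `f((t))`: the series all of whose exponents are multiples of `q`.
For `q = 0` these are the constants, in accordance with `t ^ 0 = 1`. -/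
def powSeries (f : Type*) [Field f] (q : ℕ) : Set f⸨X⸩ :=
  {h | ∀ i : ℤ, h.coeff i ≠ 0 → (q : ℤ) ∣ i}

/-- `f[t⁻¹, t]` as a subset of `f((t))`: the series with finitely many nonzero coefficients. -/
def laurentPoly (f : Type*) [Field f] : Set f⸨X⸩ :=
  {h | {i : ℤ | h.coeff i ≠ 0}.Finite}

/-- The orbit space `F / G_n` of `F = f((t))`, with the quotient topology. -/
abbrev OrbitSpace (f : Type*) [Field f] (n : ℕ) : Type _ :=
  MulAction.orbitRel.Quotient (G f n) f⸨X⸩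

/-- The canonical projection `β : F → F / G_n`, `h ↦ G_n(h)`. -/
noncomputable def proj (f : Type*) [Field f] (n : ℕ) : f⸨X⸩ → OrbitSpace f n :=
  Quotient.mk (MulAction.orbitRel (G f n) f⸨X⸩)

end FormalSing

/-! Everything rests on the expansion `g h = h + (g t - t) h' + ...`. An automorphism over `f` is an
isometry and is determined by `g t`, and every `u ∈ t + t ^ 2 f[[t]]` occurs as `g t`. If `h' ≠ 0`,
which holds for `h ∉ f((t ^ p))`, Newton iteration solves `g h = y` with `g ∈ G_n` for all `y` near
`h` (`exists_mem_G_map_eq`). So the orbit is open and meets the dense set of Laurent polynomials.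
The orbit of `h ∈ f((t ^ p))` stays in `f((t ^ p))`, which has empty interior.

A nonconstant `h` lies in some `f((t ^ q))` with `q = p ^ m` maximal (`q = 1` if `p = 0`). For an
additive `φ : f → f` with `φ (a ^ q * b) = a * φ b`, the operator `contract q φ` commutes with
automorphisms on `f((t ^ q))` (`contract_map`), and `φ` can be chosen so that `k = contract q φ h`
lies outside `f((t ^ p))`. For perfect `f` of prime characteristic, `φ` can be the `q`-th root; then
`k ^ q = h`, and openness and normal forms pass from `k` to `h`. If some `a` is not a `p`-th power,
explicit series built from `a` are counterexamples. In general `k` does not determine `h`, but its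
stabilizer is finite (`finite_stabilizer`), which suffices to show that orbits are closed.

Because `G_n` acts by isometries, closeness of representatives is a uniform structure on the orbit
space, and Cauchy sequences of orbits lift to `F`; closed orbits make the space T1. The projection
is closed for `p = 0` because nonconstant orbits are open, and for finite `f` because orbits are
compact. For infinite `f` and prime `p`, infinitely many images of `t ^ p` with distinct
coefficients in one fixed degree break closedness. -/

namespace FormalSing

variable {f : Type*} [Field f]

/-! ### The order filtration -/

/-- `OrdGE N x` says that `x ∈ t ^ N f[[t]]`. -/
def OrdGE (N : ℤ) (x : f⸨X⸩) : Prop := ∀ i < N, x.coeff i = 0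

theorem ordGE_iff {N : ℤ} {x : f⸨X⸩} : OrdGE N x ↔ (N : WithTop ℤ) ≤ x.orderTop := by
  rw [HahnSeries.le_orderTop_iff_forall]
  exact forall_congr' fun i => by rw [WithTop.coe_lt_coe]

theorem ordGE_zero_iff {x : f⸨X⸩} : OrdGE 0 x ↔ 0 ≤ x.orderTop := ordGE_iff

theorem OrdGE.zero (N : ℤ) : OrdGE N (0 : f⸨X⸩) := fun _ _ => by simp

theorem OrdGE.mono {M N : ℤ} {x : f⸨X⸩} (hx : OrdGE N x) (h : M ≤ N) : OrdGE M x :=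
  fun i hi => hx i (hi.trans_le h)

theorem OrdGE.add {N : ℤ} {x y : f⸨X⸩} (hx : OrdGE N x) (hy : OrdGE N y) : OrdGE N (x + y) :=
  fun i hi => by simp [hx i hi, hy i hi]

theorem OrdGE.neg {N : ℤ} {x : f⸨X⸩} (hx : OrdGE N x) : OrdGE N (-x) :=
  fun i hi => by simp [hx i hi]

theorem OrdGE.sub {N : ℤ} {x y : f⸨X⸩} (hx : OrdGE N x) (hy : OrdGE N y) : OrdGE N (x - y) :=
  fun i hi => by simp [hx i hi, hy i hi]

theorem OrdGE.symm {N : ℤ} {x y : f⸨X⸩} (h : OrdGE N (x - y)) : OrdGE N (y - x) := by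
  simpa using h.neg

theorem OrdGE.trans {N : ℤ} {x y z : f⸨X⸩} (h : OrdGE N (x - y)) (h' : OrdGE N (y - z)) :
    OrdGE N (x - z) := by
  simpa using h.add h'

theorem OrdGE.mul {M N : ℤ} {x y : f⸨X⸩} (hx : OrdGE M x) (hy : OrdGE N y) :
    OrdGE (M + N) (x * y) := by
  rw [ordGE_iff] at *
  rw [HahnSeries.orderTop_mul, WithTop.coe_add]
  exact add_le_add hx hy

theorem OrdGE.sum {ι : Type*} {N : ℤ} {s : Finset ι} {x : ι → f⸨X⸩}
    (h : ∀ i ∈ s, OrdGE N (x i)) : OrdGE N (∑ i ∈ s, x i) :=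
  Finset.sum_induction _ _ (fun _ _ => OrdGE.add) (OrdGE.zero N) h

theorem ordGE_single {N j : ℤ} (h : N ≤ j) (a : f) : OrdGE N (HahnSeries.single j a) := by
  intro i hi
  rw [HahnSeries.coeff_single_of_ne (by omega)]

theorem ordGE_one : OrdGE 0 (1 : f⸨X⸩) := ordGE_single le_rfl 1

theorem ordGE_C (a : f) : OrdGE 0 (HahnSeries.C a : f⸨X⸩) := ordGE_single le_rfl a

theorem ordGE_tvar : OrdGE 1 (tvar f) := ordGE_single le_rfl 1

theorem OrdGE.pow {M : ℤ} {x : f⸨X⸩} (hx : OrdGE M x) (k : ℕ) : OrdGE (k * M) (x ^ k) := by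
  induction k with
  | zero => simpa using ordGE_one
  | succ k ih =>
    rw [pow_succ]
    convert! ih.mul hx using 1
    push_cast; ring

theorem exists_ordGE (x : f⸨X⸩) : ∃ N : ℤ, OrdGE N x := by
  cases h : x.orderTop with
  | top => exact ⟨0, ordGE_iff.2 (by simp [h])⟩
  | coe k => exact ⟨k, ordGE_iff.2 (by simp [h])⟩

theorem eq_zero_of_forall_ordGE {x : f⸨X⸩} (h : ∀ N : ℕ, OrdGE N x) : x = 0 := by
  ext i
  exact h (i.toNat + 1) i (by omega)

theorem orderTop_eq_iff {x : f⸨X⸩} {k : ℤ} :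
    x.orderTop = k ↔ OrdGE k x ∧ x.coeff k ≠ 0 := by
  constructor
  · intro h
    exact ⟨ordGE_iff.2 h.ge, HahnSeries.coeff_orderTop_ne h⟩
  · rintro ⟨h, h0⟩
    refine le_antisymm ?_ (ordGE_iff.1 h)
    exact HahnSeries.orderTop_le_of_coeff_ne_zero h0

theorem exists_orderTop_eq {x : f⸨X⸩} (hx : x ≠ 0) : ∃ k : ℤ, x.orderTop = k := by
  obtain ⟨k, hk⟩ := WithTop.ne_top_iff_exists.1 (HahnSeries.orderTop_ne_top.2 hx)
  exact ⟨k, hk.symm⟩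

theorem orderTop_inv {x : f⸨X⸩} {k : ℤ} (h : x.orderTop = k) : x⁻¹.orderTop = (-k : ℤ) := by
  have hx : x ≠ 0 := by rintro rfl; simp at h
  have := HahnSeries.orderTop_mul x x⁻¹
  rw [mul_inv_cancel₀ hx, h, HahnSeries.orderTop_one] at this
  cases h' : x⁻¹.orderTop with
  | top => rw [h'] at this; simp at this
  | coe m =>
    rw [h'] at this
    norm_cast at this ⊢
    omega

/-- Cancelling a factor of known order. -/
theorem OrdGE.of_mul_left {x y : f⸨X⸩} {k N : ℤ} (hx : x.orderTop = k) (h : OrdGE N (x * y)) :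
    OrdGE (N - k) y := by
  have hx0 : x ≠ 0 := by rintro rfl; simp at hx
  have := (ordGE_iff.2 (orderTop_inv hx).ge).mul h
  rw [← mul_assoc, inv_mul_cancel₀ hx0, one_mul] at this
  exact this.mono (by omega)

theorem coeff_tvar_mul (x : f⸨X⸩) (i : ℤ) : (tvar f * x).coeff i = x.coeff (i - 1) := by
  have := HahnSeries.coeff_single_mul_add (r := (1 : f)) (x := x) (a := i - 1) (b := 1)
  rw [one_mul, sub_add_cancel] at this
  exact this

theorem tvar_ne_zero : tvar f ≠ 0 := by
  intro h
  have := orderTop_tvar (f := f)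
  rw [h] at this
  simp at this

theorem tvar_pow (k : ℕ) : tvar f ^ k = HahnSeries.single (k : ℤ) 1 := by
  rw [tvar, HahnSeries.single_pow]; simp

theorem exists_eq_tvar_mul {N : ℤ} {x : f⸨X⸩} (hx : OrdGE (N + 1) x) :
    ∃ y, OrdGE N y ∧ x = tvar f * y := by
  refine ⟨(tvar f)⁻¹ * x, ?_, by rw [mul_inv_cancel_left₀ tvar_ne_zero]⟩
  have h : OrdGE (N + 1) (tvar f * ((tvar f)⁻¹ * x)) := by
    rwa [mul_inv_cancel_left₀ tvar_ne_zero]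
  exact (h.of_mul_left orderTop_tvar).mono (by omega)

/-- The part of a series with exponents below `N`. -/
theorem exists_head (N : ℤ) (x : f⸨X⸩) : ∃ s : Finset ℤ, (∀ i ∈ s, i < N ∧ x.coeff i ≠ 0) ∧
    OrdGE N (x - ∑ i ∈ s, HahnSeries.single i (x.coeff i)) := by
  classical
  obtain ⟨M, hM⟩ := exists_ordGE x
  refine ⟨(Finset.Ico M N).filter fun i => x.coeff i ≠ 0, ?_, ?_⟩
  · intro i hi
    simp only [Finset.mem_filter, Finset.mem_Ico] at hi
    exact ⟨hi.1.2, hi.2⟩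
  · intro j hj
    rw [HahnSeries.coeff_sub, HahnSeries.coeff_sum, sub_eq_zero]
    simp only [HahnSeries.coeff_single]
    by_cases h : x.coeff j = 0
    · rw [h, Finset.sum_eq_zero]
      intro i _
      split_ifs with hij
      · rw [← hij, h]
      · rfl
    · rw [Finset.sum_eq_single j]
      · simp
      · intro i _ hij
        rw [if_neg (Ne.symm hij)]
      · intro hj'
        exfalso
        refine hj' ?_
        simp only [Finset.mem_filter, Finset.mem_Ico]
        refine ⟨⟨?_, hj⟩, h⟩
        by_contra! hlt
        exact h (hM j hlt)

/-- To prove a closed additive property of a series it is enough to check it on its monomials. -/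
theorem laurent_induction {P : f⸨X⸩ → Prop} (x : f⸨X⸩)
    (closed : (∀ N : ℕ, ∃ y, P y ∧ (∀ i, y.coeff i ≠ 0 → x.coeff i ≠ 0) ∧ OrdGE N (x - y)) → P x)
    (zero : P 0) (add : ∀ y z, P y → P z → P (y + z))
    (single : ∀ i, x.coeff i ≠ 0 → P (HahnSeries.single i (x.coeff i))) : P x := by
  refine closed fun N => ?_
  obtain ⟨s, hs, hx⟩ := exists_head N x
  refine ⟨_, Finset.sum_induction _ P add zero fun i hi => single i (hs i hi).2, ?_, hx⟩
  intro i hi h0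
  refine hi ?_
  rw [HahnSeries.coeff_sum, Finset.sum_eq_zero]
  intro j _
  rw [HahnSeries.coeff_single]
  split_ifs with hij
  · rw [← hij, h0]
  · rfl

/-- The limit of a sequence with explicit modulus of convergence. -/
theorem exists_limit (x : ℕ → f⸨X⸩) (N : ℤ)
    (h : ∀ k : ℕ, OrdGE (N + k) (x (k + 1) - x k)) :
    ∃ y, ∀ k : ℕ, OrdGE (N + k) (y - x k) := by
  have h' : ∀ k l : ℕ, k ≤ l → OrdGE (N + k) (x l - x k) := by
    intro k l hkl
    induction l, hkl using Nat.le_induction with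
    | base => simpa using OrdGE.zero _
    | succ l hl ih => exact ((h l).mono (by omega)).trans ih
  obtain ⟨M, hM⟩ := exists_ordGE (x 0)
  -- The coefficient of index `i` is constant from the term of index `i - N + 1` on, so the limit
  -- reads it there.
  have hb : ∀ i < min M N, (fun i : ℤ => (x (i - N + 1).toNat).coeff i) i = 0 := by
    intro i hi
    have : (i - N + 1).toNat = 0 := by have := min_le_right M N; omega
    simp only [this]
    exact hM i (hi.trans_le (min_le_left _ _))
  have hbdd : BddBelow (Function.support fun i : ℤ => (x (i - N + 1).toNat).coeff i) :=
    ⟨min M N, fun i hi => not_lt.1 fun hlt => absurd (hb i hlt) (Function.mem_support.1 hi)⟩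
  refine ⟨HahnSeries.ofSuppBddBelow _ hbdd, ?_⟩
  intro k i hi
  have hc : (HahnSeries.ofSuppBddBelow _ hbdd).coeff i = (x (i - N + 1).toNat).coeff i := rfl
  have := h' (i - N + 1).toNat k (by omega) i (by omega)
  rw [HahnSeries.coeff_sub, sub_eq_zero] at this
  rw [HahnSeries.coeff_sub, hc, sub_eq_zero]
  exact this.symm

/-! ### The `t`-adic topology -/

open Topology in
theorem hasBasis_nhds (x : f⸨X⸩) :
    (𝓝 x).HasBasis (fun _ : ℕ => True) fun N => {y | OrdGE N (y - x)} := by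
  have key : ∀ (N : ℤ) (z : f⸨X⸩), Valued.v z ≤ WithZero.exp (-N) ↔ OrdGE N z := fun N z =>
    LaurentSeries.valuation_le_iff_coeff_lt_eq_zero f
  constructor
  intro S
  simp only [true_and]
  rw [Valued.mem_nhds]
  constructor
  · rintro ⟨γ, hγ⟩
    have hne : MonoidWithZeroHom.ValueGroup₀.embedding γ.1 ≠ 0 := by simp
    refine ⟨(1 - WithZero.log (MonoidWithZeroHom.ValueGroup₀.embedding γ.1)).toNat, ?_⟩
    intro y hy
    refine hγ ?_
    rw [Set.mem_ofPred_eq, Valuation.restrict_lt_iff_lt_embedding]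
    refine lt_of_le_of_lt ((key _ _).2 (hy.mono (Int.self_le_toNat _))) ?_
    rw [← WithZero.lt_log_iff_exp_lt hne]
    omega
  · rintro ⟨N, hN⟩
    have h0 : Valued.v.restrict (HahnSeries.single (N : ℤ) (1 : f) : f⸨X⸩) ≠ 0 := by
      simp
    refine ⟨Units.mk0 _ h0, fun y hy => hN ?_⟩
    rw [Set.mem_ofPred_eq, Units.val_mk0, Valuation.restrict_lt_iff,
      LaurentSeries.valuation_single_zpow] at hy
    exact (key _ _).1 hy.le

theorem isOpen_iff {S : Set f⸨X⸩} :
    IsOpen S ↔ ∀ x ∈ S, ∃ N : ℕ, ∀ y, OrdGE N (y - x) → y ∈ S := by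
  rw [isOpen_iff_mem_nhds]
  refine forall₂_congr fun x _ => ?_
  rw [(hasBasis_nhds x).mem_iff]
  simp [Set.subset_def]

theorem isClosed_iff {S : Set f⸨X⸩} :
    IsClosed S ↔ ∀ x, (∀ N : ℕ, ∃ y ∈ S, OrdGE N (y - x)) → x ∈ S := by
  rw [← isOpen_compl_iff, isOpen_iff]
  constructor
  · intro H x hx
    by_contra hxS
    obtain ⟨N, hN⟩ := H x hxS
    obtain ⟨y, hy, hyN⟩ := hx N
    exact hN y hyN hy
  · intro H x hxS
    by_contra! hx
    refine hxS (H x fun N => ?_)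
    obtain ⟨y, hyN, hy⟩ := hx N
    exact ⟨y, not_not.1 hy, hyN⟩

/-! ### The derivative and endomorphisms near the identity -/

theorem coeff_derivative (x : f⸨X⸩) (i : ℤ) :
    (LaurentSeries.derivative f x).coeff i = ((i + 1 : ℤ) : f) * x.coeff (i + 1) := by
  rw [LaurentSeries.derivative_apply, LaurentSeries.hasseDeriv_coeff]
  simp [zsmul_eq_mul]

theorem derivative_C (c : f) : LaurentSeries.derivative f (HahnSeries.C c : f⸨X⸩) = 0 := by
  ext i
  rw [coeff_derivative, HahnSeries.C_apply, HahnSeries.coeff_single]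
  split_ifs with h
  · rw [h]; simp
  · simp

theorem derivative_tvar_mul (x : f⸨X⸩) :
    LaurentSeries.derivative f (tvar f * x) = x + tvar f * LaurentSeries.derivative f x := by
  ext i
  rw [coeff_derivative, HahnSeries.coeff_add, coeff_tvar_mul, coeff_tvar_mul, coeff_derivative]
  simp only [add_sub_cancel_right, sub_add_cancel]
  push_cast; ring

theorem OrdGE.derivative {a : ℤ} {x : f⸨X⸩} (hx : OrdGE a x) :
    OrdGE (a - 1) (LaurentSeries.derivative f x) := fun i hi => by
  rw [coeff_derivative, hx (i + 1) (by omega), mul_zero]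

theorem exists_eq_C_add_tvar_mul {x : f⸨X⸩} (hx : OrdGE 0 x) :
    ∃ c y, OrdGE 0 y ∧ x = HahnSeries.C c + tvar f * y := by
  have h : OrdGE (0 + 1) (x - HahnSeries.C (x.coeff 0)) := by
    intro i hi
    rcases (show i < 0 ∨ i = 0 by omega) with h | rfl
    · exact (hx.sub (ordGE_C _)) i h
    · simp [HahnSeries.C_apply]
  obtain ⟨y, hy, e⟩ := exists_eq_tvar_mul h
  exact ⟨_, y, hy, by rw [← e]; ring⟩

theorem map_C_algHom (φ : f⸨X⸩ →ₐ[f] f⸨X⸩) (c : f) : φ (HahnSeries.C c) = HahnSeries.C c := by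
  have := φ.commutes c
  rwa [LaurentSeries.algebraMap_apply] at this

section Endomorphism

variable {φ : f⸨X⸩ →ₐ[f] f⸨X⸩} {M : ℤ}

theorem orderTop_map_tvar (hM : 2 ≤ M) (ht : OrdGE M (φ (tvar f) - tvar f)) :
    (φ (tvar f)).orderTop = (1 : ℤ) := by
  have h2 := ht.mono hM
  rw [orderTop_eq_iff]
  have e : φ (tvar f) = (φ (tvar f) - tvar f) + tvar f := by ring
  constructor
  · rw [e]
    exact (h2.mono (by norm_num)).add ordGE_tvar
  · rw [e, HahnSeries.coeff_add, h2 1 (by norm_num)]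
    simp [tvar]

theorem map_sub_self_tvar_mul (x : f⸨X⸩) :
    φ (tvar f * x) - tvar f * x =
      φ (tvar f) * (φ x - x) + (φ (tvar f) - tvar f) * x := by
  rw [map_mul]; ring

/-- Continuity of `φ` is not assumed, so no termwise argument is available. Instead, writing `x = c
+ t y` gives `φ x - x = t (φ y - y) + (φ t - t) φ y`; each such step gains one order, until the
bound `M` is reached. -/
theorem OrdGE.algHom_sub_self_of_zero (hφ : ∀ x, OrdGE 0 x → OrdGE 0 (φ x))
    (ht : OrdGE M (φ (tvar f) - tvar f)) {x : f⸨X⸩} (hx : OrdGE 0 x) : OrdGE M (φ x - x) := by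
  have key : ∀ k : ℕ, ∀ x : f⸨X⸩, OrdGE 0 x → OrdGE (min k M) (φ x - x) := by
    intro k
    induction k with
    | zero => exact fun x hx => ((hφ x hx).sub hx).mono (by simp)
    | succ k ih =>
      intro x hx
      obtain ⟨c, y, hy, rfl⟩ := exists_eq_C_add_tvar_mul hx
      have e : φ (HahnSeries.C c + tvar f * y) - (HahnSeries.C c + tvar f * y) =
          tvar f * (φ y - y) + (φ (tvar f) - tvar f) * φ y := by
        rw [map_add, map_C_algHom, map_mul]; ring
      rw [e]
      exact ((ordGE_tvar.mul (ih y hy)).mono (by push_cast; omega)).add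
        ((ht.mul (hφ y hy)).mono (by omega))
  exact (key M.toNat x hx).mono (by omega)

/-- An endomorphism that is close to the identity at `t` is close to the identity everywhere. -/
theorem OrdGE.algHom_sub_self (hφ : ∀ x, OrdGE 0 x → OrdGE 0 (φ x)) (hM : 2 ≤ M)
    (ht : OrdGE M (φ (tvar f) - tvar f)) {a : ℤ} {x : f⸨X⸩} (hx : OrdGE a x) :
    OrdGE (M + a - 1) (φ x - x) := by
  have hφt := orderTop_map_tvar hM ht
  induction a using Int.induction_on generalizing x with
  | zero => exact (OrdGE.algHom_sub_self_of_zero hφ ht hx).mono (by omega)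
  | succ a ih =>
    obtain ⟨y, hy, rfl⟩ := exists_eq_tvar_mul hx
    rw [map_sub_self_tvar_mul]
    exact (((ordGE_iff.2 hφt.ge).mul (ih hy)).mono (by omega)).add
      ((ht.mul hy).mono (by omega))
  | pred a ih =>
    have h := ih (x := tvar f * x) ((ordGE_tvar.mul hx).mono (by omega))
    rw [map_sub_self_tvar_mul] at h
    have h' := h.sub ((ht.mul hx).mono (show M + -(a : ℤ) - 1 ≤ _ by omega))
    rw [add_sub_cancel_right] at h'
    exact (h'.of_mul_left hφt).mono (by omega)

/-- The first order Taylor expansion of the substitution of `φ t` for `t`. -/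
theorem OrdGE.algHom_taylor (hφ : ∀ x, OrdGE 0 x → OrdGE 0 (φ x)) (hM : 2 ≤ M)
    (ht : OrdGE M (φ (tvar f) - tvar f)) {a : ℤ} {x : f⸨X⸩} (hx : OrdGE a x) :
    OrdGE (2 * M + a - 2)
      (φ x - x - (φ (tvar f) - tvar f) * LaurentSeries.derivative f x) := by
  -- The Taylor error `E` satisfies `E (t y) = t E y + (φ t - t) (φ y - y)`, and the last product is
  -- already of second order in `φ t - t`.
  have e : ∀ y, φ (tvar f * y) - tvar f * y -
      (φ (tvar f) - tvar f) * LaurentSeries.derivative f (tvar f * y) =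
      tvar f * (φ y - y - (φ (tvar f) - tvar f) * LaurentSeries.derivative f y) +
      (φ (tvar f) - tvar f) * (φ y - y) := by
    intro y
    rw [derivative_tvar_mul, map_mul]; ring
  have key : ∀ k : ℕ, ∀ x : f⸨X⸩, OrdGE 0 x → OrdGE (min k (2 * M - 2))
      (φ x - x - (φ (tvar f) - tvar f) * LaurentSeries.derivative f x) := by
    intro k
    induction k with
    | zero =>
      exact fun x hx => ((((hφ x hx).sub hx).sub
        ((ht.mul hx.derivative).mono (by omega)))).mono (by simp)
    | succ k ih =>
      intro x hx
      obtain ⟨c, y, hy, rfl⟩ := exists_eq_C_add_tvar_mul hx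
      have e' : φ (HahnSeries.C c + tvar f * y) - (HahnSeries.C c + tvar f * y) -
          (φ (tvar f) - tvar f) * LaurentSeries.derivative f (HahnSeries.C c + tvar f * y) =
          φ (tvar f * y) - tvar f * y -
          (φ (tvar f) - tvar f) * LaurentSeries.derivative f (tvar f * y) := by
        rw [map_add, map_C_algHom, map_add, derivative_C]; ring
      rw [e', e]
      exact ((ordGE_tvar.mul (ih y hy)).mono (by push_cast; omega)).add
        ((ht.mul (OrdGE.algHom_sub_self hφ hM ht hy)).mono (by omega))
  induction a using Int.induction_on generalizing x with
  | zero => exact (key (2 * M - 2).toNat x hx).mono (by omega)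
  | succ a ih =>
    obtain ⟨y, hy, rfl⟩ := exists_eq_tvar_mul hx
    rw [e]
    exact ((ordGE_tvar.mul (ih hy)).mono (by omega)).add
      ((ht.mul (OrdGE.algHom_sub_self hφ hM ht hy)).mono (by omega))
  | pred a ih =>
    have h := ih (x := tvar f * x) ((ordGE_tvar.mul hx).mono (by omega))
    rw [e] at h
    have h' := h.sub ((ht.mul (OrdGE.algHom_sub_self hφ hM ht hx)).mono
      (show 2 * M + -(a : ℤ) - 2 ≤ _ by omega))
    rw [add_sub_cancel_right] at h'
    exact (h'.of_mul_left orderTop_tvar).mono (by omega)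

/-- `φ - id` raises orders by at least one, so `z ↦ z + (y - φ z)` is a contraction whose fixed
point is a preimage of `y`. -/
theorem bijective_of_ordGE (hφ : ∀ x, OrdGE 0 x → OrdGE 0 (φ x))
    (ht : OrdGE 2 (φ (tvar f) - tvar f)) : Function.Bijective φ := by
  refine ⟨φ.toRingHom.injective, fun y => ?_⟩
  obtain ⟨N, hN⟩ := exists_ordGE y
  have step : ∀ {a : ℤ} {x : f⸨X⸩}, OrdGE a x → OrdGE (a + 1) (φ x - x) := fun hx =>
    (OrdGE.algHom_sub_self hφ le_rfl ht hx).mono (by omega)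
  let x : ℕ → f⸨X⸩ := fun k => (fun z => z + (y - φ z))^[k] 0
  have hx : ∀ k, x (k + 1) = x k + (y - φ (x k)) := fun k => Function.iterate_succ_apply' _ _ _
  have h : ∀ k : ℕ, OrdGE (N + k) (y - φ (x k)) := by
    intro k
    induction k with
    | zero => simpa [x] using hN
    | succ k ih =>
      have e : y - φ (x (k + 1)) = -(φ (y - φ (x k)) - (y - φ (x k))) := by
        rw [hx, map_add]; ring
      rw [e]
      exact (step ih).neg.mono (by push_cast; omega)
  obtain ⟨z, hz⟩ := exists_limit x N (fun k => by rw [hx, add_sub_cancel_left]; exact h k)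
  refine ⟨z, sub_eq_zero.1 (eq_zero_of_forall_ordGE fun k => ?_)⟩
  have hk : (k : ℤ) ≤ N + (k + (-N).toNat : ℕ) := by omega
  have h1 := (hz (k + (-N).toNat)).mono hk
  have e : φ z - y = (φ (z - x (k + (-N).toNat)) - (z - x (k + (-N).toNat))) +
      (z - x (k + (-N).toNat)) - (y - φ (x (k + (-N).toNat))) := by
    rw [map_sub]; ring
  rw [e]
  exact (((step h1).mono (by omega)).add h1).sub ((h _).mono hk)

end Endomorphism

/-- Substitution of `u` for `t` is defined on `f[[t]]` and extends to the fraction field once it is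
injective. -/
theorem exists_algHom (u : f⸨X⸩) (hu : OrdGE 2 (u - tvar f)) :
    ∃ φ : f⸨X⸩ →ₐ[f] f⸨X⸩, (∀ x, OrdGE 0 x → OrdGE 0 (φ x)) ∧ φ (tvar f) = u := by
  have hu1 : OrdGE 1 u := by
    have := (hu.mono (show (1 : ℤ) ≤ 2 by norm_num)).add ordGE_tvar
    rwa [sub_add_cancel] at this
  obtain ⟨U, rfl⟩ := exists_powerSeries (ordGE_zero_iff.1 (hu1.mono zero_le_one))
  have hU : PowerSeries.constantCoeff U = 0 := by
    have := hu1 0 zero_lt_one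
    rw [PowerSeries.coeff_coe] at this
    simpa using this
  have hU1 : PowerSeries.coeff 1 U = 1 := by
    have := hu 1 (by norm_num)
    rw [HahnSeries.coeff_sub, PowerSeries.coeff_coe, sub_eq_zero] at this
    simpa [tvar] using this
  have hs := PowerSeries.HasSubst.of_constantCoeff_zero' hU
  let ψ : PowerSeries f →+* f⸨X⸩ :=
    (HahnSeries.ofPowerSeries ℤ f).comp (PowerSeries.substAlgHom (R := f) hs).toRingHom
  have hψ : ∀ P, ψ P = ((PowerSeries.subst U P : PowerSeries f) : f⸨X⸩) := fun P => by
    rw [← PowerSeries.coe_substAlgHom hs]; rfl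
  have hψX : ψ PowerSeries.X = (U : f⸨X⸩) := by rw [hψ, PowerSeries.subst_X hs]
  have hinj : Function.Injective ψ := by
    -- A nonzero prime ideal of `f[[t]]` is maximal, hence contains `t`; but `t` is sent to `U`,
    -- whose linear coefficient is `1`.
    rw [RingHom.injective_iff_ker_eq_bot]
    by_contra hne
    have hmax := (RingHom.ker_isPrime ψ).isMaximal hne
    have hX : PowerSeries.X ∈ RingHom.ker ψ := by
      rw [IsLocalRing.eq_maximalIdeal hmax, IsLocalRing.mem_maximalIdeal, mem_nonunits_iff]
      exact PowerSeries.X_prime.not_isUnit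
    rw [RingHom.mem_ker, hψX] at hX
    have := congrArg (fun z : f⸨X⸩ => z.coeff 1) hX
    simp only [PowerSeries.coeff_coe] at this
    simp [hU1] at this
  have hlift : ∀ P : PowerSeries f,
      IsFractionRing.lift hinj (P : f⸨X⸩) = ((PowerSeries.subst U P : PowerSeries f) : f⸨X⸩) :=
    fun P => (IsFractionRing.lift_algebraMap hinj P).trans (hψ P)
  refine ⟨{ IsFractionRing.lift hinj with commutes' := fun c => ?_ }, ?_, ?_⟩
  · change IsFractionRing.lift hinj _ = _
    rw [LaurentSeries.algebraMap_apply, ← PowerSeries.coe_C, hlift, PowerSeries.subst_C]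
    rfl
  · intro x hx
    obtain ⟨P, rfl⟩ := exists_powerSeries (ordGE_zero_iff.1 hx)
    change OrdGE 0 (IsFractionRing.lift hinj _)
    rw [hlift]
    exact ordGE_zero_iff.2 (orderTop_powerSeries _)
  · change IsFractionRing.lift hinj _ = _
    rw [tvar, ← PowerSeries.coe_X, hlift, PowerSeries.subst_X hs]

theorem exists_algEquiv (u : f⸨X⸩) (hu : OrdGE 2 (u - tvar f)) :
    ∃ g : f⸨X⸩ ≃ₐ[f] f⸨X⸩, g (tvar f) = u := by
  obtain ⟨φ, hφ, ht⟩ := exists_algHom u hu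
  exact ⟨AlgEquiv.ofBijective φ (bijective_of_ordGE hφ (by rwa [ht])), ht⟩

/-! ### Automorphisms as isometries -/

section Automorphism

variable (g : f⸨X⸩ ≃ₐ[f] f⸨X⸩)

theorem OrdGE.map_zero {x : f⸨X⸩} (hx : OrdGE 0 x) : OrdGE 0 (g x) :=
  ordGE_zero_iff.2 (map_nonneg g (ordGE_zero_iff.1 hx))

/-- Automorphisms are isometries. -/
theorem OrdGE.map {N : ℤ} {x : f⸨X⸩} (hx : OrdGE N x) : OrdGE N (g x) := by
  have hlt : ∀ (n : ℕ) (g : f⸨X⸩ ≃ₐ[f] f⸨X⸩) {x : f⸨X⸩}, OrdGE n x → OrdGE n (g x) := by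
    intro n g x hx
    cases n with
    | zero => exact OrdGE.map_zero g hx
    | succ n =>
      have key : ∀ y : f⸨X⸩, OrdGE ((n + 1 : ℕ) : ℤ) y ↔ ((n : ℤ) : WithTop ℤ) < y.orderTop :=
        fun y => by
          rw [← lt_orderTop_iff]
          exact forall_congr' fun i => by push_cast; rw [Int.lt_add_one_iff]
      rw [key] at *
      exact lt_orderTop_map g n hx
  by_cases hN : 0 ≤ N
  · lift N to ℕ using hN
    exact hlt N g hx
  by_cases hx0 : x = 0
  · simpa [hx0] using OrdGE.zero N
  obtain ⟨l, hl⟩ := exists_orderTop_eq hx0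
  obtain ⟨k, hk⟩ := exists_orderTop_eq (x := g x) (by simpa using hx0)
  have hNl : N ≤ l := by rw [ordGE_iff, hl] at hx; exact_mod_cast hx
  by_contra hcon
  have hkN : k < N := by
    by_contra! h
    exact hcon ((ordGE_iff.2 hk.ge).mono h)
  -- Negative orders are reduced to nonnegative ones by applying `g.symm` to `(g x)⁻¹`.
  obtain ⟨m, rfl⟩ : ∃ m : ℕ, k = -m := ⟨k.natAbs, by omega⟩
  have h1 := hlt m g.symm (x := (g x)⁻¹) (ordGE_iff.2 (by rw [orderTop_inv hk, neg_neg]))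
  rw [map_inv₀, g.symm_apply_apply, ordGE_iff, orderTop_inv hl] at h1
  have : (m : ℤ) ≤ -l := by exact_mod_cast h1
  omega

theorem OrdGE.map_iff {N : ℤ} {x : f⸨X⸩} : OrdGE N (g x) ↔ OrdGE N x :=
  ⟨fun h => by simpa using h.map g.symm, OrdGE.map g⟩

theorem orderTop_map (x : f⸨X⸩) : (g x).orderTop = x.orderTop := by
  by_cases hx : x = 0
  · simp [hx]
  · obtain ⟨k, hk⟩ := exists_orderTop_eq hx
    obtain ⟨l, hl⟩ := exists_orderTop_eq (x := g x) (by simpa using hx)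
    have h1 := (OrdGE.map_iff g).1 (ordGE_iff.2 hl.ge)
    have h2 := (OrdGE.map_iff g).2 (ordGE_iff.2 hk.ge)
    rw [ordGE_iff, hk] at h1
    rw [ordGE_iff, hl] at h2
    rw [hk, hl]
    exact le_antisymm h1 h2

theorem OrdGE.map_sub_self {M a : ℤ} (hM : 2 ≤ M) (ht : OrdGE M (g (tvar f) - tvar f))
    {x : f⸨X⸩} (hx : OrdGE a x) : OrdGE (M + a - 1) (g x - x) :=
  OrdGE.algHom_sub_self (φ := g.toAlgHom) (fun _ => OrdGE.map_zero g) hM ht hx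

theorem OrdGE.map_taylor {M a : ℤ} (hM : 2 ≤ M) (ht : OrdGE M (g (tvar f) - tvar f))
    {x : f⸨X⸩} (hx : OrdGE a x) : OrdGE (2 * M + a - 2)
      (g x - x - (g (tvar f) - tvar f) * LaurentSeries.derivative f x) :=
  OrdGE.algHom_taylor (φ := g.toAlgHom) (fun _ => OrdGE.map_zero g) hM ht hx

theorem mem_G_iff {n : ℕ} : g ∈ G f n ↔ OrdGE (n + 1) (g (tvar f) - tvar f) := by
  change (∀ i : ℤ, i ≤ n → _) ↔ _
  exact forall_congr' fun i => by rw [Int.lt_add_one_iff]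

end Automorphism

/-! ### Newton iteration and open orbits -/

theorem derivative_ne_zero (p : ℕ) [CharP f p] {h : f⸨X⸩} (hh : h ∉ powSeries f p) :
    LaurentSeries.derivative f h ≠ 0 := by
  intro h0
  refine hh fun i hi => ?_
  have := congrArg (fun z : f⸨X⸩ => z.coeff (i - 1)) h0
  simp only [coeff_derivative, sub_add_cancel, HahnSeries.coeff_zero, mul_eq_zero, hi,
    or_false] at this
  exact (CharP.intCast_eq_zero_iff f p i).1 this

/-- One step of the Newton iteration. -/
theorem exists_newton_step {h : f⸨X⸩} {a e M : ℤ} (ha : OrdGE a h)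
    (he : (LaurentSeries.derivative f h).orderTop = e) (hM : 2 ≤ M) (hMe : e + 3 - a ≤ M)
    {z : f⸨X⸩} (hz : OrdGE (e + M) z) :
    ∃ r : f⸨X⸩ ≃ₐ[f] f⸨X⸩, OrdGE M (r (tvar f) - tvar f) ∧
      OrdGE (e + M + 1) (z - (r h - h)) := by
  obtain ⟨he1, he2⟩ := orderTop_eq_iff.1 he
  set c : f := z.coeff (e + M) / (LaurentSeries.derivative f h).coeff e with hc
  have hs : OrdGE M (HahnSeries.single M c : f⸨X⸩) := ordGE_single le_rfl c
  obtain ⟨r, hr⟩ := exists_algEquiv (tvar f + HahnSeries.single M c)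
    (by rw [add_sub_cancel_left]; exact hs.mono hM)
  have hrt : r (tvar f) - tvar f = HahnSeries.single M c := by rw [hr, add_sub_cancel_left]
  have hrt' : OrdGE M (r (tvar f) - tvar f) := by rwa [hrt]
  refine ⟨r, hrt', ?_⟩
  -- The Taylor error has order at least `2 * M + a - 2`; this is at least `e + M + 1` precisely
  -- when `e + 3 - a ≤ M`. The linear term cancels the coefficient of `z` at `e + M` by the choice
  -- of `c`.
  have hT := OrdGE.map_taylor r hM hrt' ha
  rw [hrt] at hT
  have e1 : z - (r h - h) = (z - HahnSeries.single M c * LaurentSeries.derivative f h) -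
      (r h - h - HahnSeries.single M c * LaurentSeries.derivative f h) := by ring
  rw [e1]
  refine OrdGE.sub ?_ (hT.mono (by omega))
  intro i hi
  rcases (show i < e + M ∨ i = e + M by omega) with h | rfl
  · exact (hz.sub ((hs.mul he1).mono (by omega))) i h
  · rw [HahnSeries.coeff_sub, HahnSeries.coeff_single_mul_add, hc, div_mul_cancel₀ _ he2, sub_self]

/-- Series close to `h` are in the orbit of `h` when the derivative of `h` does not vanish. -/
theorem exists_mem_G_map_eq {h : f⸨X⸩} (hd : LaurentSeries.derivative f h ≠ 0) (n : ℕ) :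
    ∃ B : ℕ, ∀ y, OrdGE B (y - h) → ∃ g ∈ G f n, g h = y := by
  obtain ⟨e, he⟩ := exists_orderTop_eq hd
  obtain ⟨a, ha⟩ := exists_ordGE h
  obtain ⟨M, hM2, hMe, hMn⟩ : ∃ M : ℤ, 2 ≤ M ∧ e + 3 - a ≤ M ∧ (n : ℤ) + 1 ≤ M :=
    ⟨max (max 2 (e + 3 - a)) (n + 1), by simp, by simp, by simp⟩
  refine ⟨(e + M).toNat, fun y hy => ?_⟩
  -- The residual is pulled back by the isometry `g` and corrected at `h` itself, with the
  -- correction composed on the right. Thus the same `a` and `e` serve at every step.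
  have step : ∀ (k : ℕ) (g : f⸨X⸩ ≃ₐ[f] f⸨X⸩), ∃ g' : f⸨X⸩ ≃ₐ[f] f⸨X⸩,
      OrdGE (e + M + k) (y - g h) → OrdGE (M + k) (g' (tvar f) - g (tvar f)) ∧
        OrdGE (e + M + k + 1) (y - g' h) := by
    intro k g
    by_cases hg : OrdGE (e + M + k) (y - g h)
    · have hz := hg.map g.symm
      obtain ⟨r, hr, hr'⟩ := exists_newton_step (M := M + k) ha he (by omega) (by omega)
        (hz.mono (by omega))
      refine ⟨g * r, fun _ => ⟨?_, ?_⟩⟩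
      · have := hr.map g
        rwa [map_sub] at this
      · have := hr'.map g
        rw [map_sub g.symm, g.symm_apply_apply, sub_sub_sub_cancel_right, map_sub,
          g.apply_symm_apply] at this
        exact this.mono (by omega)
    · exact ⟨g, fun h => absurd h hg⟩
  choose F hF using step
  let s : ℕ → (f⸨X⸩ ≃ₐ[f] f⸨X⸩) := fun k => Nat.rec 1 F k
  have hs : ∀ k, s (k + 1) = F k (s k) := fun _ => rfl
  have hsk : ∀ k : ℕ, OrdGE (e + M + k) (y - s k h) := by
    intro k
    induction k with
    | zero => exact hy.mono (by push_cast; omega)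
    | succ k ih =>
      rw [hs]
      exact (hF k _ ih).2.mono (by push_cast; omega)
  obtain ⟨u, hu⟩ := exists_limit (fun k => s k (tvar f)) M fun k => by
    simp only [hs]; exact (hF k _ (hsk k)).1
  have hu0 : OrdGE M (u - tvar f) := (hu 0).mono (by simp)
  obtain ⟨g, hg⟩ := exists_algEquiv u (hu0.mono hM2)
  refine ⟨g, ?_, ?_⟩
  · rw [mem_G_iff, hg]
    exact hu0.mono hMn
  · refine sub_eq_zero.1 (eq_zero_of_forall_ordGE fun N => ?_)
    obtain ⟨k, hk1, hk2⟩ : ∃ k : ℕ, (N : ℤ) ≤ M + k + a - 1 ∧ (N : ℤ) ≤ e + M + k :=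
      ⟨N + (a - 1).natAbs + e.natAbs, by omega, by omega⟩
    -- Since `(s k)⁻¹ * g` is close to the identity at `t`, it moves `h` little; hence `g h` is
    -- close to `s k h`, which is close to `y`.
    have h1 : OrdGE (M + k) (((s k)⁻¹ * g) (tvar f) - tvar f) := by
      have := (hu k).map (s k)⁻¹
      rw [map_sub, ← AlgEquiv.mul_apply, inv_mul_cancel, ← hg] at this
      exact this
    have h2 := (OrdGE.map_sub_self _ (by omega) h1 ha).map (s k)
    rw [map_sub, AlgEquiv.mul_apply, ← AlgEquiv.mul_apply, mul_inv_cancel, AlgEquiv.one_apply] at h2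
    exact (h2.mono hk1).trans ((hsk k).symm.mono hk2)

theorem mem_orbit_iff {n : ℕ} {h y : f⸨X⸩} :
    y ∈ MulAction.orbit (G f n) h ↔ ∃ g ∈ G f n, g h = y := by
  rw [MulAction.mem_orbit_iff]
  constructor
  · rintro ⟨⟨g, hg⟩, rfl⟩
    exact ⟨g, hg, rfl⟩
  · rintro ⟨g, hg, rfl⟩
    exact ⟨⟨g, hg⟩, rfl⟩

/-- Orbits of series outside `f((t ^ p))` are open. -/
theorem isOpen_orbit (p : ℕ) [CharP f p] (n : ℕ) {h : f⸨X⸩} (hh : h ∉ powSeries f p) :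
    IsOpen (MulAction.orbit (G f n) h) := by
  rw [isOpen_iff]
  intro x hx
  obtain ⟨g, hg, rfl⟩ := mem_orbit_iff.1 hx
  obtain ⟨B, hB⟩ := exists_mem_G_map_eq (derivative_ne_zero p hh) n
  refine ⟨B, fun y hy => ?_⟩
  have := hy.map g.symm
  rw [map_sub, g.symm_apply_apply] at this
  obtain ⟨r, hr, e⟩ := hB _ this
  exact mem_orbit_iff.2 ⟨g * r, mul_mem hg hr, by
    rw [AlgEquiv.mul_apply, e, g.apply_symm_apply]⟩

theorem exists_laurentPoly (N : ℕ) (h : f⸨X⸩) : ∃ y ∈ laurentPoly f, OrdGE N (y - h) := by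
  obtain ⟨s, _, hs⟩ := exists_head N h
  refine ⟨_, ?_, hs.symm⟩
  refine s.finite_toSet.subset fun i hi => ?_
  by_contra his
  refine hi ?_
  rw [HahnSeries.coeff_sum]
  refine Finset.sum_eq_zero fun j hj => HahnSeries.coeff_single_of_ne ?_
  rintro rfl
  exact his hj

theorem orbit_inter_laurentPoly_nonempty (p : ℕ) [CharP f p] (n : ℕ) {h : f⸨X⸩}
    (hh : h ∉ powSeries f p) : (MulAction.orbit (G f n) h ∩ laurentPoly f).Nonempty := by
  obtain ⟨N, hN⟩ := isOpen_iff.1 (isOpen_orbit p n hh) h (MulAction.mem_orbit_self h)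
  obtain ⟨y, hy, hyN⟩ := exists_laurentPoly N h
  exact ⟨y, hN y hyN, hy⟩

/-! ### Powers `x ^ q` and the subfields `f((t ^ q))` -/

/-- `q` is an exponent for which `x ↦ x ^ q` is additive on `f((t))`. -/
structure AddPow (f : Type*) [Field f] (q : ℕ) : Prop where
  ne_zero : q ≠ 0
  add_pow : ∀ x y : f⸨X⸩, (x + y) ^ q = x ^ q + y ^ q

theorem addPow_one : AddPow f 1 := ⟨one_ne_zero, by simp⟩

theorem addPow_prime_pow {p : ℕ} [CharP f p] (hp : p.Prime) (m : ℕ) : AddPow f (p ^ m) := by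
  have : Fact p.Prime := ⟨hp⟩
  have : CharP f⸨X⸩ p := charP_of_injective_algebraMap (algebraMap f f⸨X⸩).injective p
  exact ⟨pow_ne_zero _ hp.ne_zero, fun x y => add_pow_char_pow x y p m⟩

theorem addPow_prime {p : ℕ} [CharP f p] (hp : p.Prime) : AddPow f p := by
  simpa using addPow_prime_pow hp 1

theorem single_mul_eq (q : ℕ) (j : ℤ) (a : f) :
    HahnSeries.single ((q : ℤ) * j) a = HahnSeries.C a * HahnSeries.single j (1 : f) ^ q := by
  rw [HahnSeries.single_pow, HahnSeries.C_apply, HahnSeries.single_mul_single]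
  simp

theorem zero_mem_powSeries (q : ℕ) : (0 : f⸨X⸩) ∈ powSeries f q := fun i hi => by simp at hi

theorem add_mem_powSeries {q : ℕ} {x y : f⸨X⸩} (hx : x ∈ powSeries f q) (hy : y ∈ powSeries f q) :
    x + y ∈ powSeries f q := by
  intro i hi
  by_cases h : x.coeff i = 0
  · refine hy i fun h' => hi ?_
    rw [HahnSeries.coeff_add, h, h', add_zero]
  · exact hx i h

theorem mem_powSeries_of_approx {q : ℕ} {x : f⸨X⸩}
    (h : ∀ N : ℕ, ∃ y ∈ powSeries f q, OrdGE N (x - y)) : x ∈ powSeries f q := by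
  intro i hi
  obtain ⟨y, hy, hxy⟩ := h (i + 1).toNat
  refine hy i fun h0 => hi ?_
  have := hxy i (by omega)
  rwa [HahnSeries.coeff_sub, h0, sub_zero] at this

theorem C_mul_mem_powSeries {q : ℕ} (a : f) {x : f⸨X⸩} (hx : x ∈ powSeries f q) :
    HahnSeries.C a * x ∈ powSeries f q := by
  intro i hi
  rw [HahnSeries.C_mul_eq_smul, HahnSeries.coeff_smul] at hi
  exact hx i (right_ne_zero_of_smul hi)

theorem mem_powSeries_zero_iff {x : f⸨X⸩} :
    x ∈ powSeries f 0 ↔ x ∈ Set.range (algebraMap f f⸨X⸩) := by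
  constructor
  · intro h
    refine ⟨x.coeff 0, ?_⟩
    rw [LaurentSeries.algebraMap_apply, HahnSeries.C_apply]
    ext i
    rw [HahnSeries.coeff_single]
    split_ifs with hi
    · rw [hi]
    · by_contra h0
      have := h i (Ne.symm h0)
      rw [Nat.cast_zero, zero_dvd_iff] at this
      exact hi this
  · rintro ⟨c, rfl⟩ i hi
    rw [LaurentSeries.algebraMap_apply, HahnSeries.C_apply, HahnSeries.coeff_single] at hi
    split_ifs at hi with h
    · simp [h]
    · exact absurd rfl hi

theorem algebraMap_mem_powSeries (q : ℕ) (c : f) : algebraMap f f⸨X⸩ c ∈ powSeries f q := by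
  intro i hi
  rw [LaurentSeries.algebraMap_apply, HahnSeries.C_apply, HahnSeries.coeff_single] at hi
  split_ifs at hi with h
  · rw [h]; exact dvd_zero _
  · exact absurd rfl hi

namespace AddPow

variable {q : ℕ}

theorem sub_pow (hq : AddPow f q) (x y : f⸨X⸩) : (x - y) ^ q = x ^ q - y ^ q := by
  rw [eq_sub_iff_add_eq, ← hq.add_pow, sub_add_cancel]

/-- Both claims are additive in `x` and survive limits, so monomials suffice. -/
theorem pow_aux (hq : AddPow f q) (x : f⸨X⸩) :
    (∀ i, (x ^ q).coeff (q * i) = x.coeff i ^ q) ∧ x ^ q ∈ powSeries f q := by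
  have hq0 : (q : ℤ) ≠ 0 := by exact_mod_cast hq.ne_zero
  refine laurent_induction
    (P := fun x => (∀ i, (x ^ q).coeff (q * i) = x.coeff i ^ q) ∧ x ^ q ∈ powSeries f q)
    x (fun h => ⟨fun i => ?_, mem_powSeries_of_approx fun N => ?_⟩) ?_ ?_ ?_
  · obtain ⟨y, ⟨hy, -⟩, -, hxy⟩ := h (i + 1).toNat
    have h1 := (hxy.mono (Int.self_le_toNat _)).pow q (q * i) (by
      have : (0 : ℤ) < q := by omega
      nlinarith)
    have h2 := hxy i (by omega)
    rw [hq.sub_pow, HahnSeries.coeff_sub, sub_eq_zero] at h1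
    rw [HahnSeries.coeff_sub, sub_eq_zero] at h2
    rw [h1, hy, h2]
  · obtain ⟨y, ⟨-, hy⟩, -, hxy⟩ := h N
    refine ⟨_, hy, ?_⟩
    rw [← hq.sub_pow]
    refine (hxy.pow q).mono ?_
    have : (0 : ℤ) < q := by omega
    nlinarith
  · refine ⟨fun i => by simp [hq.ne_zero], by simpa [hq.ne_zero] using zero_mem_powSeries q⟩
  · rintro y z ⟨hy, hy'⟩ ⟨hz, hz'⟩
    refine ⟨fun i => ?_, by rw [hq.add_pow]; exact add_mem_powSeries hy' hz'⟩
    have := hq.add_pow (HahnSeries.C (y.coeff i)) (HahnSeries.C (z.coeff i))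
    rw [← map_add, ← map_pow, ← map_pow, ← map_pow, ← map_add] at this
    rw [hq.add_pow, HahnSeries.coeff_add, hy, hz, HahnSeries.coeff_add, HahnSeries.C_injective this]
  · intro j _
    rw [HahnSeries.single_pow]
    constructor
    · intro i
      rw [HahnSeries.coeff_single, HahnSeries.coeff_single]
      by_cases hij : i = j
      · simp [hij]
      · have : (q : ℤ) * i ≠ q • j := by
          rw [nsmul_eq_mul]
          exact fun h => hij (mul_left_cancel₀ hq0 h)
        rw [if_neg hij, if_neg this, zero_pow hq.ne_zero]
    · intro i hi
      rw [HahnSeries.coeff_single] at hi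
      split_ifs at hi with h
      · rw [h, nsmul_eq_mul]; exact dvd_mul_right _ _
      · exact absurd rfl hi

theorem coeff_pow (hq : AddPow f q) (x : f⸨X⸩) (i : ℤ) :
    (x ^ q).coeff (q * i) = x.coeff i ^ q := (hq.pow_aux x).1 i

theorem pow_mem_powSeries (hq : AddPow f q) (x : f⸨X⸩) : x ^ q ∈ powSeries f q :=
  (hq.pow_aux x).2

/-- `x ↦ x ^ q` as an endomorphism of `f`. -/
def frob (hq : AddPow f q) : f →+* f where
  toFun x := x ^ q
  map_one' := one_pow q
  map_mul' x y := mul_pow x y q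
  map_zero' := zero_pow hq.ne_zero
  map_add' x y := by
    have := hq.add_pow (HahnSeries.C x) (HahnSeries.C y)
    rw [← map_add, ← map_pow, ← map_pow, ← map_pow, ← map_add] at this
    exact HahnSeries.C_injective this

/-- `f((t ^ q))` is the closed `f`-span of `q`-th powers, because `t ^ (q j) = (t ^ j) ^ q`.
Automorphisms are isometric, fix `f` and send `q`-th powers to `q`-th powers. -/
theorem map_mem_powSeries (hq : AddPow f q) (g : f⸨X⸩ ≃ₐ[f] f⸨X⸩) {x : f⸨X⸩}
    (hx : x ∈ powSeries f q) : g x ∈ powSeries f q := by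
  refine laurent_induction (P := fun x => g x ∈ powSeries f q) x
    (fun h => mem_powSeries_of_approx fun N => ?_) ?_ ?_ ?_
  · obtain ⟨y, hy, -, hxy⟩ := h N
    exact ⟨g y, hy, by rw [← map_sub]; exact hxy.map g⟩
  · rw [map_zero]; exact zero_mem_powSeries q
  · intro y z hy hz
    rw [map_add]; exact add_mem_powSeries hy hz
  · intro i hi
    obtain ⟨j, rfl⟩ := hx i hi
    rw [single_mul_eq, map_mul, map_C, map_pow]
    exact C_mul_mem_powSeries _ (hq.pow_mem_powSeries _)

end AddPow

theorem map_mem_powSeries_char (p : ℕ) [CharP f p] (g : f⸨X⸩ ≃ₐ[f] f⸨X⸩) {x : f⸨X⸩}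
    (hx : x ∈ powSeries f p) : g x ∈ powSeries f p := by
  rcases CharP.char_is_prime_or_zero f p with hp | rfl
  · exact (addPow_prime hp).map_mem_powSeries g hx
  · rw [mem_powSeries_zero_iff] at *
    obtain ⟨c, rfl⟩ := hx
    exact ⟨c, (g.commutes c).symm⟩

/-! ### Contraction operators -/

/-- The operator `∑ a_i t ^ i ↦ ∑ φ(a_{q i}) t ^ i`. -/
noncomputable def contract (q : ℕ) (φ : f →+ f) (x : f⸨X⸩) : f⸨X⸩ :=
  open Classical in
  if h : BddBelow (Function.support fun i : ℤ => φ (x.coeff (q * i))) then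
    HahnSeries.ofSuppBddBelow _ h else 0

section contract

variable {q : ℕ} {φ : f →+ f}

theorem coeff_contract (hq : q ≠ 0) (x : f⸨X⸩) (i : ℤ) :
    (contract q φ x).coeff i = φ (x.coeff (q * i)) := by
  have h : BddBelow (Function.support fun i : ℤ => φ (x.coeff (q * i))) := by
    obtain ⟨N, hN⟩ := exists_ordGE x
    refine ⟨-|N|, fun j hj => ?_⟩
    by_contra! hlt
    refine hj ?_
    have h1 : (q : ℤ) * j < N := by
      have : (1 : ℤ) ≤ q := by omega
      have := neg_abs_le N
      have := abs_nonneg N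
      nlinarith
    simp only [hN _ h1, map_zero]
  rw [contract, dif_pos h]
  rfl

theorem contract_add (hq : q ≠ 0) (x y : f⸨X⸩) :
    contract q φ (x + y) = contract q φ x + contract q φ y := by
  ext i
  simp [coeff_contract hq]

theorem contract_sub (hq : q ≠ 0) (x y : f⸨X⸩) :
    contract q φ (x - y) = contract q φ x - contract q φ y := by
  ext i
  simp [coeff_contract hq]

theorem OrdGE.contract (hq : q ≠ 0) {N : ℤ} {x : f⸨X⸩} (hx : OrdGE (q * N) x) :
    OrdGE N (contract q φ x) := by
  intro i hi
  have : (0 : ℤ) < q := by omega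
  rw [coeff_contract hq, hx _ (by nlinarith), _root_.map_zero]

/-- Semilinearity of `φ` makes the contraction of `a * x ^ q` equal to `φ a * x` for every series
`x`, and `g` maps `a * (t ^ j) ^ q` to `a * (g (t ^ j)) ^ q`. Monomials suffice by continuity. -/
theorem contract_map (hq : AddPow f q) (hφ : ∀ a b, φ (a ^ q * b) = a * φ b)
    (g : f⸨X⸩ ≃ₐ[f] f⸨X⸩) {x : f⸨X⸩} (hx : x ∈ powSeries f q) :
    contract q φ (g x) = g (contract q φ x) := by
  have hq0 := hq.ne_zero
  refine laurent_induction (P := fun x => contract q φ (g x) = g (contract q φ x)) x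
    (fun h => sub_eq_zero.1 (eq_zero_of_forall_ordGE fun N => ?_)) ?_ ?_ ?_
  · obtain ⟨y, hy, -, hxy⟩ := h (q * N)
    have hxy' : OrdGE ((q : ℤ) * N) (x - y) := hxy.mono (by push_cast; rfl)
    have h1 := (hxy'.map g).contract (φ := φ) hq0
    have h2 := (hxy'.contract (φ := φ) hq0).map g
    rw [map_sub, contract_sub hq0, hy] at h1
    rw [contract_sub hq0, map_sub] at h2
    exact h1.trans h2.symm
  · have : contract q φ (0 : f⸨X⸩) = 0 := by ext i; simp [coeff_contract hq0]
    rw [map_zero, this, map_zero]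
  · intro y z hy hz
    rw [map_add, contract_add hq0, contract_add hq0, map_add, hy, hz]
  · intro i hi
    obtain ⟨j, rfl⟩ := hx i hi
    set a := x.coeff (q * j)
    have e : contract q φ (HahnSeries.single ((q : ℤ) * j) a) =
        HahnSeries.C (φ a) * HahnSeries.single j 1 := by
      ext i
      rw [coeff_contract hq0, HahnSeries.C_mul_eq_smul, HahnSeries.coeff_smul,
        HahnSeries.coeff_single, HahnSeries.coeff_single]
      by_cases hij : i = j
      · simp [hij]
      · simp [hij, hq0]
    rw [e, single_mul_eq, map_mul, map_mul, map_C, map_C, map_pow]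
    ext i
    rw [coeff_contract hq0, HahnSeries.C_mul_eq_smul, HahnSeries.C_mul_eq_smul,
      HahnSeries.coeff_smul, HahnSeries.coeff_smul, hq.coeff_pow, smul_eq_mul, smul_eq_mul,
      mul_comm, hφ, mul_comm]

theorem contract_pow (hq : AddPow f q) (hφ : ∀ a, φ a ^ q = a) {x : f⸨X⸩}
    (hx : x ∈ powSeries f q) : contract q φ x ^ q = x := by
  ext i
  by_cases hi : (q : ℤ) ∣ i
  · obtain ⟨j, rfl⟩ := hi
    rw [hq.coeff_pow, coeff_contract hq.ne_zero, hφ]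
  · rw [not_imp_comm.1 (hx i) hi, not_imp_comm.1 (hq.pow_mem_powSeries _ i) hi]

end contract

/-- Semilinear functionals. -/
theorem exists_semilinear_functional {K V : Type*} [Field K] [Field V] (σ : K →+* V) {a : V}
    (ha : a ≠ 0) : ∃ φ : V →+ K, (∀ c b, φ (σ c * b) = c * φ b) ∧ φ a = 1 := by
  let _ : Module K V := Module.compHom V σ
  obtain ⟨φ, hφ⟩ := Module.Projective.exists_dual_eq_one K ha
  exact ⟨φ.toAddMonoidHom, fun c b => φ.map_smul c b, hφ⟩

/-- A nonzero exponent `i` is not divisible by `p ^ |i|`, so membership in `f((t ^ (p ^ m)))` fails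
for some first index, which is not `0`. -/
theorem exists_mem_powSeries_diff {p : ℕ} (hp : p.Prime) {h : f⸨X⸩}
    (hh : h ∉ Set.range (algebraMap f f⸨X⸩)) :
    ∃ m, h ∈ powSeries f (p ^ m) \ powSeries f (p ^ (m + 1)) := by
  classical
  have hex : ∃ m, h ∉ powSeries f (p ^ m) := by
    rw [← mem_powSeries_zero_iff] at hh
    simp only [powSeries, Set.mem_ofPred_eq, not_forall] at hh ⊢
    obtain ⟨i, hi, hi0⟩ := hh
    rw [Nat.cast_zero, zero_dvd_iff] at hi0
    refine ⟨i.natAbs, i, hi, fun hdvd => ?_⟩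
    have h1 := Int.natAbs_dvd_natAbs.2 hdvd
    have h2 := Nat.le_of_dvd (Int.natAbs_pos.2 hi0) h1
    rw [Int.natAbs_natCast] at h2
    exact absurd h2 (not_le.2 (Nat.lt_pow_self hp.one_lt))
  obtain ⟨m, hm⟩ : ∃ m, Nat.find hex = m + 1 := by
    refine Nat.exists_eq_succ_of_ne_zero fun h0 => ?_
    have := Nat.find_spec hex
    rw [h0] at this
    exact this fun i _ => by simp
  refine ⟨m, not_not.1 (Nat.find_min hex (by omega)), ?_⟩
  rw [← hm]
  exact Nat.find_spec hex

theorem exists_not_pow_of_not_perfectField {p : ℕ} [CharP f p] (hp : p.Prime)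
    (h : ¬ PerfectField f) : ∃ a : f, ∀ b, b ^ p ≠ a := by
  by_contra! H
  have : Fact p.Prime := ⟨hp⟩
  have : ExpChar f p := ExpChar.prime hp
  have : PerfectRing f p := PerfectRing.ofSurjective f p H
  exact h (PerfectRing.toPerfectField f p)

/-- The inverse of `x ↦ x ^ (p ^ m)` on a perfect field. -/
theorem exists_root_hom {p : ℕ} [CharP f p] (hp : p.Prime) [PerfectField f] (m : ℕ) :
    ∃ φ : f →+ f, (∀ a, φ a ^ p ^ m = a) ∧ ∀ a b, φ (a ^ p ^ m * b) = a * φ b := by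
  have : Fact p.Prime := ⟨hp⟩
  have : ExpChar f p := ExpChar.prime hp
  have : PerfectRing f p := PerfectField.toPerfectRing p
  refine ⟨(iterateFrobeniusEquiv f p m).symm.toRingHom.toAddMonoidHom, fun a => ?_, fun a b => ?_⟩
  · exact (iterateFrobeniusEquiv f p m).apply_symm_apply a
  · change (iterateFrobeniusEquiv f p m).symm _ = a * (iterateFrobeniusEquiv f p m).symm b
    rw [map_mul]
    congr 1
    exact (iterateFrobeniusEquiv f p m).symm_apply_apply a

/-! ### Divided differences and finite stabilizers -/

section DividedDifference

variable {K : Type*} [Field K] [DecidableEq K]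

/-- The divided difference of `X ^ j` at the nodes in `U`. -/
noncomputable def powDividedDiff (U : Finset K) (j : ℕ) : K :=
  ∑ u ∈ U, u ^ j / ∏ v ∈ U.erase u, (u - v)

/-- By Lagrange interpolation, the divided difference is the coefficient of degree `U.card - 1` of
`X ^ j` when `j < U.card`. -/
theorem powDividedDiff_of_lt {U : Finset K} {j : ℕ} (h : j + 1 < U.card) :
    powDividedDiff U j = 0 := by
  have := Lagrange.coeff_eq_sum (s := U) (v := id) (Set.injOn_id _)
    (P := (Polynomial.X ^ j : Polynomial K)) (by
      rw [Polynomial.degree_X_pow]; exact_mod_cast (Nat.lt_succ_self j).trans h)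
  rw [Polynomial.coeff_X_pow, if_neg (by omega)] at this
  simpa [powDividedDiff] using this.symm

theorem powDividedDiff_of_eq {U : Finset K} {j : ℕ} (h : U.card = j + 1) :
    powDividedDiff U j = 1 := by
  have := Lagrange.coeff_eq_sum (s := U) (v := id) (Set.injOn_id _)
    (P := (Polynomial.X ^ j : Polynomial K)) (by
      rw [Polynomial.degree_X_pow, h]; exact_mod_cast Nat.lt_succ_self j)
  rw [Polynomial.coeff_X_pow, if_pos (by omega)] at this
  simpa [powDividedDiff] using this.symm

theorem powDividedDiff_succ {U : Finset K} {w : K} (hw : w ∈ U) (j : ℕ) :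
    powDividedDiff U (j + 1) = powDividedDiff (U.erase w) j + w * powDividedDiff U j := by
  rw [← sub_eq_iff_eq_add]
  simp only [powDividedDiff]
  rw [Finset.mul_sum, ← Finset.sum_sub_distrib, ← Finset.add_sum_erase _ _ hw]
  have h0 : w ^ (j + 1) / ∏ v ∈ U.erase w, (w - v) -
      w * (w ^ j / ∏ v ∈ U.erase w, (w - v)) = 0 := by ring
  rw [h0, zero_add]
  refine Finset.sum_congr rfl fun u hu => ?_
  have huw : u - w ≠ 0 := sub_ne_zero.2 (Finset.ne_of_mem_erase hu)
  have hw' : w ∈ U.erase u := Finset.mem_erase.2 ⟨(Finset.ne_of_mem_erase hu).symm, hw⟩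
  rw [← Finset.mul_prod_erase _ _ hw', Finset.erase_right_comm]
  rw [show u ^ (j + 1) / ((u - w) * ∏ v ∈ (U.erase w).erase u, (u - v)) -
    w * (u ^ j / ((u - w) * ∏ v ∈ (U.erase w).erase u, (u - v))) =
    (u - w) * u ^ j / ((u - w) * ∏ v ∈ (U.erase w).erase u, (u - v)) by ring]
  exact mul_div_mul_left _ _ huw

end DividedDifference

-- This divided difference is a complete homogeneous symmetric polynomial of positive degree in the
-- nodes; the recursion `powDividedDiff_succ` avoids introducing it.
open Classical in
theorem ordGE_powDividedDiff {U : Finset f⸨X⸩} (hU : ∀ u ∈ U, OrdGE 1 u) {j : ℕ}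
    (h0 : U.Nonempty) (hj : U.card ≤ j) : OrdGE 1 (powDividedDiff U j) := by
  induction hc : U.card generalizing U j with
  | zero => exact absurd hc h0.card_ne_zero
  | succ c ih =>
    obtain ⟨w, hw⟩ := h0
    have hce : (U.erase w).card = c := by rw [Finset.card_erase_of_mem hw, hc]; rfl
    have h1 : ∀ j, c ≤ j → OrdGE 1 (powDividedDiff (U.erase w) j) := by
      intro j hj
      rcases (U.erase w).eq_empty_or_nonempty with he | he
      · rw [he]; simpa [powDividedDiff] using OrdGE.zero _
      · exact ih (fun u hu => hU u (Finset.mem_of_mem_erase hu)) he (by omega) hce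
    rw [hc] at hj
    induction j, hj using Nat.le_induction with
    | base =>
      rw [powDividedDiff_succ hw, powDividedDiff_of_eq hc, mul_one]
      exact (h1 c le_rfl).add (hU w hw)
    | succ j hj ih' =>
      rw [powDividedDiff_succ hw]
      exact (h1 j (by omega)).add (((hU w hw).mul ih').mono (by norm_num))

open Classical in
/-- A series of order `d` takes a given value at most `d` times. -/
theorem card_le_of_map_eq_self {k : f⸨X⸩} {d : ℕ} (hd : d ≠ 0) (hk : k.orderTop = (d : ℤ))
    {U : Finset f⸨X⸩} (hU : ∀ u ∈ U, ∃ g : f⸨X⸩ ≃ₐ[f] f⸨X⸩, g k = k ∧ g (tvar f) = u) :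
    U.card ≠ d + 1 := by
  intro hcard
  choose! g hgk hgt using hU
  set w : f⸨X⸩ → f⸨X⸩ := fun u => (∏ v ∈ U.erase u, (u - v))⁻¹ with hw
  obtain ⟨hk1, hk2⟩ := orderTop_eq_iff.1 hk
  have hU1 : ∀ u ∈ U, OrdGE 1 u := fun u hu => by
    rw [← hgt u hu]; exact ordGE_tvar.map _
  -- `L x` is the divided difference of `u ↦ x(u)`, as `g u` substitutes `u` for `t`. All `k(u)`
  -- equal `k`, so `L k = 0`; computed on monomials, however, `L k` has the leading coefficient of
  -- `k` as its constant term.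
  set L : f⸨X⸩ → f⸨X⸩ := fun x => ∑ u ∈ U, w u * g u x with hL
  have hLadd : ∀ x y, L (x + y) = L x + L y := fun x y => by
    simp only [hL, map_add, mul_add, Finset.sum_add_distrib]
  have hLsingle : ∀ (j : ℕ) (a : f), L (HahnSeries.single (j : ℤ) a) =
      HahnSeries.C a * powDividedDiff U j := fun j a => by
    simp only [hL, powDividedDiff, Finset.mul_sum]
    refine Finset.sum_congr rfl fun u hu => ?_
    have : HahnSeries.single (j : ℤ) a = HahnSeries.C a * tvar f ^ j := by
      rw [tvar_pow, HahnSeries.C_apply, HahnSeries.single_mul_single]; simp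
    rw [this, map_mul, map_C, map_pow, hgt u hu, hw]
    ring
  have hL0 : L k = 0 := by
    have h0 := powDividedDiff_of_lt (U := U) (j := 0) (by omega)
    have : L k = powDividedDiff U 0 * k := by
      simp only [hL, powDividedDiff, Finset.sum_mul]
      refine Finset.sum_congr rfl fun u hu => ?_
      rw [hgk u hu, hw, pow_zero, one_div]
    rw [this, h0, zero_mul]
  obtain ⟨m, hm⟩ : ∃ m : ℤ, ∀ u ∈ U, OrdGE m (w u) := by
    choose m hm using fun u => exists_ordGE (w u)
    obtain ⟨b, hb⟩ := (U.image m).bddBelow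
    exact ⟨b, fun u hu => (hm u).mono (hb (by simpa using ⟨u, hu, rfl⟩))⟩
  have hLord : ∀ (N : ℤ) x, OrdGE N x → OrdGE (m + N) (L x) := fun N x hx =>
    OrdGE.sum fun u hu => (hm u hu).mul (hx.map _)
  set x := k - HahnSeries.single (d : ℤ) (k.coeff d) with hx
  have hxd : ∀ i, x.coeff i ≠ 0 → (d : ℤ) < i := by
    intro i hi
    by_contra! hle
    rcases hle.lt_or_eq with h | rfl
    · exact hi ((hk1.sub (ordGE_single le_rfl _)) i h)
    · exact hi (by simp [hx])
  have hLx : OrdGE 1 (L x) := by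
    refine laurent_induction (P := fun x => OrdGE 1 (L x)) x (fun h => ?_) ?_ ?_ ?_
    · obtain ⟨y, hy, -, hxy⟩ := h (1 - m).toNat
      have e : x = y + (x - y) := by ring
      rw [e, hLadd]
      exact hy.add ((hLord _ _ hxy).mono (by omega))
    · simpa [hL] using OrdGE.zero _
    · intro y z hy hz
      rw [hLadd]
      exact hy.add hz
    · intro i hi
      have := hxd i hi
      lift i to ℕ using by omega
      rw [hLsingle]
      exact ((ordGE_C _).mul (ordGE_powDividedDiff hU1 (Finset.card_pos.1 (by omega))
        (by omega))).mono (by norm_num)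
  have e : k = x + HahnSeries.single (d : ℤ) (k.coeff d) := by rw [hx]; ring
  rw [e, hLadd, hLsingle, powDividedDiff_of_eq hcard, mul_one] at hL0
  have h1 := hLx 0 zero_lt_one
  have h2 := congrArg (fun z : f⸨X⸩ => z.coeff 0) hL0
  simp only [HahnSeries.coeff_add, h1, HahnSeries.C_apply, HahnSeries.coeff_single_same, zero_add,
    HahnSeries.coeff_zero] at h2
  exact hk2 h2

theorem eq_of_map_tvar_eq {g g' : f⸨X⸩ ≃ₐ[f] f⸨X⸩} (h : g (tvar f) = g' (tvar f)) : g = g' := by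
  ext1 x
  have h1 : (g'⁻¹ * g) (tvar f) - tvar f = 0 := by
    rw [AlgEquiv.mul_apply, h, ← AlgEquiv.mul_apply, inv_mul_cancel, AlgEquiv.one_apply, sub_self]
  obtain ⟨a, ha⟩ := exists_ordGE x
  have h2 : (g'⁻¹ * g) x - x = 0 := eq_zero_of_forall_ordGE fun N =>
    (OrdGE.map_sub_self _ (M := 2 + N + a.natAbs) (by omega) (h1 ▸ OrdGE.zero _) ha).mono (by omega)
  have h3 : g' ((g'⁻¹ * g) x) = g x := by
    rw [← AlgEquiv.mul_apply, mul_inv_cancel_left]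
  rw [← h3, sub_eq_zero.1 h2]

/-- The stabilizer of a nonconstant series is finite. -/
theorem finite_stabilizer {k : f⸨X⸩} (hk : k ∉ Set.range (algebraMap f f⸨X⸩)) :
    {g : f⸨X⸩ ≃ₐ[f] f⸨X⸩ | g k = k}.Finite := by
  have key : ∀ (k : f⸨X⸩) (d : ℤ), 0 < d → k.orderTop = d →
      {g : f⸨X⸩ ≃ₐ[f] f⸨X⸩ | g k = k}.Finite := by
    intro k d hd hkd
    lift d to ℕ using hd.le
    refine Set.Finite.of_finite_image (f := fun g => g (tvar f)) ?_
      fun g _ g' _ h => eq_of_map_tvar_eq h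
    by_contra hinf
    obtain ⟨U, hU, hc⟩ := Set.Infinite.exists_subset_card_eq hinf (d + 1)
    refine card_le_of_map_eq_self (by omega) hkd (fun u hu => ?_) hc
    obtain ⟨g, hg, e⟩ := hU hu
    exact ⟨g, hg, e⟩
  have hk0 : k ≠ 0 := by
    rintro rfl
    exact hk ⟨0, map_zero _⟩
  obtain ⟨e, he⟩ := exists_orderTop_eq hk0
  -- Inverting `k`, or subtracting its constant term, makes the order positive, and whatever fixes
  -- `k` fixes the new series.
  rcases lt_trichotomy e 0 with h | rfl | h
  · refine (key k⁻¹ (-e) (by omega) (orderTop_inv he)).subset fun g hg => ?_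
    rw [Set.mem_ofPred_eq, map_inv₀, hg]
  · have hpos := sub_C_pos (h := k) he.ge
    have hne : k - HahnSeries.C (k.coeff 0) ≠ 0 := fun h0 => hk ⟨k.coeff 0, by
      rw [LaurentSeries.algebraMap_apply]; exact (sub_eq_zero.1 h0).symm⟩
    obtain ⟨d, hd⟩ := exists_orderTop_eq hne
    refine (key _ d (by rw [hd] at hpos; exact_mod_cast hpos) hd).subset fun g hg => ?_
    rw [Set.mem_ofPred_eq, map_sub, map_C, hg]
  · exact key k e h he

/-! ### Orbits in `f((t ^ p))`, and closedness of all orbits -/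

/-- Adding `t ^ i` with large `i` prime to `p` leaves `f((t ^ p))`, whereas automorphisms preserve
it. -/
theorem not_isOpen_orbit (p : ℕ) [CharP f p] (n : ℕ) {h : f⸨X⸩} (hh : h ∈ powSeries f p) :
    ¬ IsOpen (MulAction.orbit (G f n) h) := by
  intro ho
  obtain ⟨N, hN⟩ := isOpen_iff.1 ho h (MulAction.mem_orbit_self h)
  obtain ⟨i, hi, hpi⟩ : ∃ i : ℤ, (N : ℤ) ≤ i ∧ ¬ (p : ℤ) ∣ i := by
    by_contra! H
    have h1 := (Int.dvd_sub (H (N + 1) (by omega)) (H N le_rfl))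
    rw [add_sub_cancel_left] at h1
    have h2 : p ∣ 1 := by exact_mod_cast h1
    exact CharP.char_ne_one f p (Nat.dvd_one.1 h2)
  obtain ⟨g, -, hg⟩ := mem_orbit_iff.1 (hN (h + HahnSeries.single i 1)
    (by rw [add_sub_cancel_left]; exact ordGE_single hi 1))
  have h1 := map_mem_powSeries_char p g hh
  rw [hg] at h1
  have h2 : h.coeff i = 0 := not_imp_comm.1 (hh i) hpi
  refine hpi (h1 i ?_)
  simp [h2]

/-- Every nonconstant series `h` has, up to `q`-th powers, a coordinate outside `f((t ^ p))`. -/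
theorem exists_contract_notMem (p : ℕ) [CharP f p] {h : f⸨X⸩}
    (hh : h ∉ Set.range (algebraMap f f⸨X⸩)) :
    ∃ q, ∃ φ : f →+ f, AddPow f q ∧ (∀ a b, φ (a ^ q * b) = a * φ b) ∧ h ∈ powSeries f q ∧
      contract q φ h ∉ powSeries f p := by
  rcases CharP.char_is_prime_or_zero f p with hp | rfl
  · obtain ⟨m, hm, hm'⟩ := exists_mem_powSeries_diff hp hh
    have hq : AddPow f (p ^ m) := addPow_prime_pow hp m
    simp only [powSeries, Set.mem_ofPred_eq, not_forall] at hm'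
    obtain ⟨i, hi, hpi⟩ := hm'
    obtain ⟨j, rfl⟩ := hm i hi
    -- With `φ` equal to `1` on the coefficient of an exponent `p ^ m * j` not divisible by `p ^ (m
    -- + 1)`, the exponent `j`, prime to `p`, survives contraction.
    obtain ⟨φ, hφ, hφ1⟩ := exists_semilinear_functional hq.frob hi
    refine ⟨p ^ m, φ, hq, hφ, hm, fun hmem => hpi ?_⟩
    have := hmem j (by rw [coeff_contract hq.ne_zero, hφ1]; exact one_ne_zero)
    rw [pow_succ, Nat.cast_mul]
    exact mul_dvd_mul_left _ this
  · refine ⟨1, AddMonoidHom.id f, addPow_one, by simp, fun i _ => by simp, ?_⟩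
    have : contract 1 (AddMonoidHom.id f) h = h := by
      ext i; simp [coeff_contract one_ne_zero]
    rwa [this, mem_powSeries_zero_iff]

/-- A limit of points of the orbit of `k ∉ f((t ^ p))` lies in that orbit. -/
theorem exists_map_eq_of_approx (p : ℕ) [CharP f p] (n : ℕ) {k y : f⸨X⸩} (hk : k ∉ powSeries f p)
    (hy : ∀ N : ℕ, ∃ g ∈ G f n, OrdGE N (g k - y)) : ∃ g ∈ G f n, g k = y := by
  have hyp : y ∉ powSeries f p := by
    intro hyp
    refine hk (mem_powSeries_of_approx fun N => ?_)
    obtain ⟨g, -, hg⟩ := hy N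
    refine ⟨g.symm y, map_mem_powSeries_char p _ hyp, ?_⟩
    have := hg.map g.symm
    rwa [map_sub, g.symm_apply_apply] at this
  obtain ⟨B, hB⟩ := exists_mem_G_map_eq (derivative_ne_zero p hyp) n
  obtain ⟨g, hg, hgy⟩ := hy B
  obtain ⟨r, hr, e⟩ := hB _ hgy
  refine ⟨r⁻¹ * g, mul_mem (inv_mem hr) hg, ?_⟩
  rw [AlgEquiv.mul_apply, ← e, ← AlgEquiv.mul_apply, inv_mul_cancel, AlgEquiv.one_apply]

/-- Let `y` be a limit of series `g h`. Contraction turns this into a limit in the orbit of `k`,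
which is attained, say by `g₀`; replacing `y` by `g₀⁻¹ y` makes its contraction equal to `k`. Each
good `g` then fixes `k` up to a factor `r` near the identity, so `y` is a limit of values `s h` with
`s` in the finite stabilizer of `k`. -/
theorem isClosed_orbit (p : ℕ) [CharP f p] (n : ℕ) (h : f⸨X⸩) :
    IsClosed (MulAction.orbit (G f n) h) := by
  by_cases hh : h ∈ Set.range (algebraMap f f⸨X⸩)
  · obtain ⟨c, rfl⟩ := hh
    refine isClosed_iff.2 fun y hy => mem_orbit_iff.2 ⟨1, one_mem _, ?_⟩
    refine sub_eq_zero.1 (eq_zero_of_forall_ordGE fun N => ?_)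
    obtain ⟨z, hz, hzy⟩ := hy N
    obtain ⟨g, -, rfl⟩ := mem_orbit_iff.1 hz
    rwa [g.commutes] at hzy
  obtain ⟨q, φ, hq, hφ, hhq, hk⟩ := exists_contract_notMem p hh
  have hq0 := hq.ne_zero
  set k := contract q φ h with hkdef
  have hkc : k ∉ Set.range (algebraMap f f⸨X⸩) := by
    rintro ⟨c, hc⟩
    exact hk (hc ▸ algebraMap_mem_powSeries p c)
  refine isClosed_iff.2 fun y hy => ?_
  have hy' : ∀ N : ℕ, ∃ g ∈ G f n, OrdGE N (g h - y) := fun N => by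
    obtain ⟨z, hz, hzy⟩ := hy N
    obtain ⟨g, hg, rfl⟩ := mem_orbit_iff.1 hz
    exact ⟨g, hg, hzy⟩
  have hcontr : ∀ (N : ℕ) (g : f⸨X⸩ ≃ₐ[f] f⸨X⸩) (y : f⸨X⸩), OrdGE ((q * N : ℕ) : ℤ) (g h - y) →
      OrdGE N (g k - contract q φ y) := fun N g y hg => by
    rw [hkdef, ← contract_map hq hφ g hhq, ← contract_sub hq0]
    exact OrdGE.contract hq0 (hg.mono (by push_cast; rfl))
  obtain ⟨g₀, hg₀, hky⟩ := exists_map_eq_of_approx p n (y := contract q φ y) hk fun N => by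
    obtain ⟨g, hg, hgy⟩ := hy' (q * N)
    exact ⟨g, hg, hcontr N g y hgy⟩
  have hyq : y ∈ powSeries f q := mem_powSeries_of_approx fun N => by
    obtain ⟨g, -, hgy⟩ := hy' N
    exact ⟨g h, hq.map_mem_powSeries g hhq, hgy.symm⟩
  set y₀ := g₀.symm y with hy₀
  have hy₀k : contract q φ y₀ = k := by
    rw [hy₀, contract_map hq hφ _ hyq, ← hky, g₀.symm_apply_apply]
  have happ : ∀ N : ℕ, ∃ g ∈ G f n, OrdGE N (g h - y₀) := fun N => by
    obtain ⟨g, hg, hgy⟩ := hy' N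
    refine ⟨g₀⁻¹ * g, mul_mem (inv_mem hg₀) hg, ?_⟩
    have := hgy.map g₀⁻¹
    rwa [map_sub] at this
  have hfin : ((fun s : f⸨X⸩ ≃ₐ[f] f⸨X⸩ => s h) '' {s | s k = k ∧ s ∈ G f n}).Finite :=
    ((finite_stabilizer hkc).subset fun s hs => hs.1).image _
  obtain ⟨a, ha⟩ := exists_ordGE y₀
  have hmem := isClosed_iff.1 hfin.isClosed y₀ fun N => by
    -- The index `n + N + |a| + 2` forces `r⁻¹ ∈ G_n` and lets `r⁻¹` move `y₀`, of order at least
    -- `a`, only in degrees at least `N`. In the precision `q * B + N`, the first summand survives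
    -- contraction as `B` and the second keeps `r⁻¹ (g h)` near `y₀`.
    obtain ⟨B, hB⟩ := exists_mem_G_map_eq (derivative_ne_zero p hk) (n + N + a.natAbs + 2)
    obtain ⟨g, hg, hgy⟩ := happ (q * B + N)
    have h1 := hcontr B g y₀ (hgy.mono (by push_cast; omega))
    rw [hy₀k] at h1
    obtain ⟨r, hr, e⟩ := hB _ h1
    rw [mem_G_iff] at hr
    have hr' : r⁻¹ ∈ G f (n + N + a.natAbs + 2) := inv_mem ((mem_G_iff _).2 hr)
    rw [mem_G_iff] at hr'
    refine ⟨_, ⟨r⁻¹ * g, ⟨?_, mul_mem ((mem_G_iff _).2 (hr'.mono (by omega))) hg⟩, rfl⟩, ?_⟩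
    · rw [AlgEquiv.mul_apply, ← e, ← AlgEquiv.mul_apply, inv_mul_cancel, AlgEquiv.one_apply]
    · have h2 := (hgy.mono (show (N : ℤ) ≤ _ by push_cast; nlinarith)).map r⁻¹
      rw [map_sub] at h2
      exact h2.trans ((OrdGE.map_sub_self r⁻¹ (by omega) hr' ha).mono (by omega))
  obtain ⟨s, ⟨-, hs⟩, e⟩ := hmem
  refine mem_orbit_iff.2 ⟨g₀ * s, mul_mem hg₀ hs, ?_⟩
  change g₀ (s h) = y
  rw [show s h = y₀ from e, hy₀, g₀.apply_symm_apply]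

/-! ### Perfectness -/

theorem laurentPoly_pow {q : ℕ} (hq : AddPow f q) {x : f⸨X⸩} (hx : x ∈ laurentPoly f) :
    x ^ q ∈ laurentPoly f := by
  refine (Set.Finite.image (fun i : ℤ => (q : ℤ) * i) hx).subset fun i hi => ?_
  obtain ⟨j, rfl⟩ := hq.pow_mem_powSeries x i hi
  refine ⟨j, fun h0 => hi ?_, rfl⟩
  rw [hq.coeff_pow, h0, zero_pow hq.ne_zero]

theorem contract_root_notMem {p : ℕ} [CharP f p] (hp : p.Prime) {m : ℕ} {φ : f →+ f}
    (hφ : ∀ a, φ a ^ p ^ m = a) {h : f⸨X⸩}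
    (hh : h ∈ powSeries f (p ^ m) \ powSeries f (p ^ (m + 1))) :
    contract (p ^ m) φ h ∉ powSeries f p := by
  have hq : AddPow f (p ^ m) := addPow_prime_pow hp m
  intro hmem
  refine hh.2 fun i hi => ?_
  obtain ⟨j, rfl⟩ := hh.1 i hi
  rw [pow_succ, Nat.cast_mul]
  refine mul_dvd_mul_left _ (hmem j fun h0 => hi ?_)
  rw [coeff_contract hq.ne_zero] at h0
  rw [← hφ (h.coeff _), h0, zero_pow hq.ne_zero]

/-- On `f((t ^ q))` with `q = p ^ m`, taking `q`-th roots is continuous, injective and equivariant,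
so the orbit of `h` is the preimage of the open orbit of its root. -/
theorem isOpen_orbit_relative (p : ℕ) [CharP f p] (n : ℕ) [PerfectField f] {h : f⸨X⸩} {m : ℕ}
    (hh : h ∈ powSeries f (p ^ m) \ powSeries f (p ^ (m + 1))) :
    IsOpen ((↑) ⁻¹' MulAction.orbit (G f n) h : Set (powSeries f (p ^ m))) := by
  rcases CharP.char_is_prime_or_zero f p with hp | rfl
  · have hq : AddPow f (p ^ m) := addPow_prime_pow hp m
    obtain ⟨φ, hφ, hφ'⟩ := exists_root_hom (f := f) hp m
    have hk := contract_root_notMem hp hφ hh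
    refine isOpen_induced_iff.2 ⟨{y | contract (p ^ m) φ y ∈
      MulAction.orbit (G f n) (contract (p ^ m) φ h)}, ?_, ?_⟩
    · refine isOpen_iff.2 fun x hx => ?_
      obtain ⟨N, hN⟩ := isOpen_iff.1 (isOpen_orbit p n hk) _ hx
      refine ⟨p ^ m * N, fun y hy => hN _ ?_⟩
      rw [← contract_sub hq.ne_zero]
      exact OrdGE.contract hq.ne_zero (hy.mono (by push_cast; rfl))
    · ext ⟨y, hy⟩
      simp only [Set.mem_preimage, Set.mem_ofPred_eq, mem_orbit_iff]
      refine exists_congr fun g => and_congr_right fun _ => ?_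
      rw [← contract_map hq hφ' g hh.1]
      refine ⟨fun e => ?_, fun e => by rw [e]⟩
      rw [← contract_pow hq hφ hy, ← contract_pow hq hφ (hq.map_mem_powSeries g hh.1), e]
  -- In characteristic zero, `0 ^ m = 0 ^ (m + 1)` for `m > 0`, so only `m = 0` with `0 ^ 0 = 1`
  -- occurs.
  · obtain rfl : m = 0 := by
      by_contra hm
      refine hh.2 ?_
      have := hh.1
      rwa [zero_pow hm] at this
    refine (isOpen_orbit 0 n fun h0 => hh.2 ?_).preimage continuous_subtype_val
    simpa using h0

theorem exists_laurentPoly_of_perfectField (p : ℕ) [CharP f p] (n : ℕ) [PerfectField f]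
    (h : f⸨X⸩) : (MulAction.orbit (G f n) h ∩ laurentPoly f).Nonempty := by
  by_cases hc : h ∈ Set.range (algebraMap f f⸨X⸩)
  · obtain ⟨c, rfl⟩ := hc
    refine ⟨_, MulAction.mem_orbit_self _, (Set.finite_singleton (0 : ℤ)).subset fun i hi => ?_⟩
    rw [Set.mem_ofPred_eq, LaurentSeries.algebraMap_apply, HahnSeries.C_apply,
      HahnSeries.coeff_single] at hi
    by_contra h0
    exact hi (if_neg h0)
  rcases CharP.char_is_prime_or_zero f p with hp | rfl
  · obtain ⟨m, hm⟩ := exists_mem_powSeries_diff hp hc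
    have hq : AddPow f (p ^ m) := addPow_prime_pow hp m
    obtain ⟨φ, hφ, -⟩ := exists_root_hom (f := f) hp m
    obtain ⟨y, hy, hyp⟩ :=
      orbit_inter_laurentPoly_nonempty p n (contract_root_notMem hp hφ hm)
    obtain ⟨g, hg, rfl⟩ := mem_orbit_iff.1 hy
    refine ⟨_, mem_orbit_iff.2 ⟨g, hg, rfl⟩, ?_⟩
    rw [← contract_pow hq hφ hm.1, map_pow]
    exact laurentPoly_pow hq hyp
  · exact orbit_inter_laurentPoly_nonempty 0 n (by rwa [mem_powSeries_zero_iff])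

/-- The orbit of `t ^ p` consists of `p`-th powers, whose coefficients are `p`-th powers in `f`. If
`a` is not one, the series `t ^ p + a t ^ (p N)` approach `t ^ p` inside `f((t ^ p))` but miss its
orbit. -/
theorem perfectField_of_isOpen (p : ℕ) [CharP f p] (n : ℕ)
    (H : ∀ h : f⸨X⸩, h ∉ Set.range (algebraMap f f⸨X⸩) → ∀ m : ℕ,
        h ∈ powSeries f (p ^ m) \ powSeries f (p ^ (m + 1)) →
        IsOpen ((↑) ⁻¹' MulAction.orbit (G f n) h : Set (powSeries f (p ^ m)))) :
    PerfectField f := by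
  rcases CharP.char_is_prime_or_zero f p with hp | rfl
  swap
  · have := CharP.charP_to_charZero f
    infer_instance
  by_contra hperf
  obtain ⟨a, ha⟩ := exists_not_pow_of_not_perfectField hp hperf
  have hq : AddPow f p := addPow_prime hp
  have hp0 : (p : ℤ) ≠ 0 := by exact_mod_cast hp.ne_zero
  have e : tvar f ^ p = HahnSeries.single (p : ℤ) 1 := tvar_pow p
  have hm : tvar f ^ p ∈ powSeries f (p ^ 1) \ powSeries f (p ^ (1 + 1)) := by
    refine ⟨by rw [pow_one]; exact hq.pow_mem_powSeries _, fun h => ?_⟩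
    have h1 := h p (by rw [e]; simp)
    have h2 : p ^ 2 ∣ p ^ 1 := by rw [pow_one]; exact_mod_cast h1
    exact absurd ((Nat.pow_dvd_pow_iff_le_right hp.one_lt).1 h2) (by norm_num)
  have hc : tvar f ^ p ∉ Set.range (algebraMap f f⸨X⸩) := by
    rw [← mem_powSeries_zero_iff]
    intro h
    have := h p (by rw [e]; simp)
    rw [Nat.cast_zero, zero_dvd_iff] at this
    exact hp0 this
  obtain ⟨V, hV, hVe⟩ := isOpen_induced_iff.1 (H _ hc 1 hm)
  have hin : ∀ y : f⸨X⸩, y ∈ powSeries f (p ^ 1) →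
      (y ∈ V ↔ y ∈ MulAction.orbit (G f n) (tvar f ^ p)) := fun y hy =>
    Set.ext_iff.1 hVe ⟨y, hy⟩
  obtain ⟨N, hN⟩ := isOpen_iff.1 hV _ ((hin _ hm.1).2 (MulAction.mem_orbit_self _))
  have hy : tvar f ^ p + HahnSeries.single ((p : ℤ) * (N + 2 : ℕ)) a ∈ powSeries f (p ^ 1) := by
    refine add_mem_powSeries hm.1 ?_
    rw [single_mul_eq, pow_one]
    exact C_mul_mem_powSeries _ (hq.pow_mem_powSeries _)
  obtain ⟨g, -, hg⟩ := mem_orbit_iff.1 ((hin _ hy).1 (hN _ (by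
    rw [add_sub_cancel_left]
    refine ordGE_single ?_ a
    have : (1 : ℤ) ≤ p := by exact_mod_cast hp.one_lt.le
    push_cast; nlinarith)))
  have h1 := congrArg (fun z : f⸨X⸩ => z.coeff ((p : ℤ) * (N + 2 : ℕ))) hg
  have hne : (p : ℤ) * (N + 2 : ℕ) ≠ p := fun h => by
    have : ((N + 2 : ℕ) : ℤ) = 1 := mul_left_cancel₀ hp0 (by rw [h, mul_one])
    omega
  rw [map_pow] at h1
  simp only [hq.coeff_pow, HahnSeries.coeff_add, e, HahnSeries.coeff_single_same] at h1
  rw [HahnSeries.coeff_single_of_ne hne, zero_add] at h1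
  exact ha _ h1

/-- A nonnegative Laurent polynomial is a polynomial. -/
theorem exists_polynomial {x : f⸨X⸩} (hx : x ∈ laurentPoly f) (h0 : OrdGE 0 x) :
    ∃ P : Polynomial f, x = ((P : PowerSeries f) : f⸨X⸩) := by
  obtain ⟨Q, rfl⟩ := exists_powerSeries (ordGE_zero_iff.1 h0)
  obtain ⟨B, hB⟩ := hx.bddAbove
  refine ⟨PowerSeries.trunc (B + 1).toNat Q, ?_⟩
  congr 1
  ext i
  rw [Polynomial.coeff_coe, PowerSeries.coeff_trunc]
  split_ifs with h
  · rfl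
  · by_contra hne
    have := hB (show (i : ℤ) ∈ _ by
      rw [Set.mem_ofPred_eq, LaurentSeries.coeff_coe_powerSeries]; exact hne)
    omega

/-- If `a` is not a `p`-th power, `t ^ p + a (1 + t) ^ (-p)` has no normal form. As `1` and `a` are
independent over the `p`-th powers, no cancellation occurs in `u ^ p + a (1 + u) ^ (-p)`, so a
normal form would make both `u` and `(1 + u)⁻¹` polynomials. Then `1 + u` would be a unit of `f[t]`,
hence constant, but `u` has order `1`. -/
theorem perfectField_of_laurentPoly (p : ℕ) [CharP f p] (n : ℕ)
    (H : ∀ h : f⸨X⸩, (MulAction.orbit (G f n) h ∩ laurentPoly f).Nonempty) :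
    PerfectField f := by
  rcases CharP.char_is_prime_or_zero f p with hp | rfl
  swap
  · have := CharP.charP_to_charZero f
    infer_instance
  by_contra hperf
  obtain ⟨a, ha⟩ := exists_not_pow_of_not_perfectField hp hperf
  have hq : AddPow f p := addPow_prime hp
  have ha' : ∀ x y : f, x ^ p + a * y ^ p = 0 → x = 0 ∧ y = 0 := by
    intro x y h
    by_cases hy : y = 0
    · rw [hy, zero_pow hp.ne_zero, mul_zero, add_zero] at h
      exact ⟨pow_eq_zero_iff hp.ne_zero |>.1 h, hy⟩
    · exfalso
      refine ha (-x / y) ?_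
      have hneg : (-x) ^ p = -x ^ p := map_neg hq.frob x
      rw [div_pow, hneg, div_eq_iff (pow_ne_zero _ hy)]
      linear_combination -h
  obtain ⟨_, hy, hyp⟩ := H (tvar f ^ p + HahnSeries.C a * ((1 + tvar f)⁻¹) ^ p)
  obtain ⟨g, -, rfl⟩ := mem_orbit_iff.1 hy
  have e : g (tvar f ^ p + HahnSeries.C a * ((1 + tvar f)⁻¹) ^ p) =
      g (tvar f) ^ p + HahnSeries.C a * ((1 + g (tvar f))⁻¹) ^ p := by
    rw [map_add, map_mul, map_C, map_pow, map_pow, map_inv₀, map_add, map_one]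
  rw [e] at hyp
  set u := g (tvar f)
  have hu : u.orderTop = (1 : ℤ) := by rw [orderTop_map, orderTop_tvar]
  have h1u : (1 + u).orderTop = (0 : ℤ) := by
    rw [HahnSeries.orderTop_add_eq_left, HahnSeries.orderTop_one]
    · rfl
    · rw [HahnSeries.orderTop_one, hu]; exact_mod_cast zero_lt_one
  have hfin : ∀ i, u.coeff i ≠ 0 ∨ (1 + u)⁻¹.coeff i ≠ 0 →
      (u ^ p + HahnSeries.C a * ((1 + u)⁻¹) ^ p).coeff (p * i) ≠ 0 := by
    intro i hi h0
    rw [HahnSeries.coeff_add, HahnSeries.C_mul_eq_smul, HahnSeries.coeff_smul, hq.coeff_pow,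
      hq.coeff_pow, smul_eq_mul] at h0
    obtain ⟨h1, h2⟩ := ha' _ _ h0
    exact hi.elim (fun h => h h1) fun h => h h2
  have hinj : Function.Injective fun i : ℤ => (p : ℤ) * i :=
    mul_right_injective₀ (by exact_mod_cast hp.ne_zero)
  have hfin' := Set.Finite.preimage hinj.injOn hyp
  obtain ⟨P, hP⟩ := exists_polynomial (x := u)
    (hfin'.subset fun i hi => hfin i (Or.inl hi)) ((ordGE_iff.2 hu.ge).mono zero_le_one)
  obtain ⟨Q, hQ⟩ := exists_polynomial (x := (1 + u)⁻¹)
    (hfin'.subset fun i hi => hfin i (Or.inr hi)) (ordGE_iff.2 (orderTop_inv h1u).ge)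
  have h1u0 : 1 + u ≠ 0 := by intro h; rw [h] at h1u; simp at h1u
  have hPQ : (1 + P) * Q = 1 := by
    have := mul_inv_cancel₀ h1u0
    rw [hQ, hP] at this
    have inj1 : Function.Injective (HahnSeries.ofPowerSeries ℤ f) :=
      HahnSeries.ofPowerSeries_injective
    apply Polynomial.coe_injective f
    apply inj1
    push_cast
    exact this
  obtain ⟨c, -, hc⟩ := Polynomial.isUnit_iff.1 (IsUnit.of_mul_eq_one _ hPQ)
  have hc' : P = Polynomial.C (c - 1) := by
    rw [map_sub, hc, map_one]; ring
  have h1 := (orderTop_eq_iff.1 hu).2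
  rw [hP, hc', Polynomial.coe_C, PowerSeries.coe_C, HahnSeries.C_apply,
    HahnSeries.coeff_single_of_ne one_ne_zero] at h1
  exact h1 rfl

/-! ### The orbit space -/

theorem proj_eq_iff {n : ℕ} {x y : f⸨X⸩} : proj f n x = proj f n y ↔ ∃ g ∈ G f n, g y = x := by
  rw [← mem_orbit_iff]
  exact Quotient.eq (r := MulAction.orbitRel (G f n) f⸨X⸩)

theorem proj_surjective (n : ℕ) : Function.Surjective (proj f n) := Quotient.mk_surjective

instance (n : ℕ) : ContinuousConstSMul (G f n) f⸨X⸩ where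
  continuous_const_smul g := by
    refine continuous_def.2 fun S hS => isOpen_iff.2 fun x hx => ?_
    obtain ⟨N, hN⟩ := isOpen_iff.1 hS _ hx
    refine ⟨N, fun y hy => hN _ ?_⟩
    have := hy.map g.1
    rwa [map_sub] at this

theorem isOpenQuotientMap_proj (n : ℕ) : IsOpenQuotientMap (proj f n) :=
  MulAction.isOpenQuotientMap_quotientMk

open Topology in
theorem hasBasis_nhds_proj (n : ℕ) (x : f⸨X⸩) :
    (𝓝 (proj f n x)).HasBasis (fun _ : ℕ => True) fun N => proj f n '' {y | OrdGE N (y - x)} := by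
  rw [← (isOpenQuotientMap_proj n).map_nhds_eq]
  exact (hasBasis_nhds x).map _

instance (n : ℕ) : T1Space (OrbitSpace f n) where
  t1 a := by
    obtain ⟨h, rfl⟩ := proj_surjective n a
    rw [← (isOpenQuotientMap_proj n).isQuotientMap.isClosed_preimage]
    convert! isClosed_orbit (ringChar f) n h using 1
    ext y
    rw [Set.mem_preimage, Set.mem_singleton_iff, proj_eq_iff, mem_orbit_iff]

/-- Two orbits are related if they have representatives that agree below exponent `N`. -/
def orbitClose (f : Type*) [Field f] (n N : ℕ) : SetRel (OrbitSpace f n) (OrbitSpace f n) :=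
  {a | ∃ x y, proj f n x = a.1 ∧ proj f n y = a.2 ∧ OrdGE N (x - y)}

/-- The representative of the first orbit may be prescribed because `G_n` acts by isometries. This
gives the triangle property and the lifting of Cauchy sequences. -/
theorem orbitClose.exists_rep {n N : ℕ} {x : f⸨X⸩} {b : OrbitSpace f n}
    (h : (proj f n x, b) ∈ orbitClose f n N) : ∃ y, proj f n y = b ∧ OrdGE N (y - x) := by
  obtain ⟨x', y, hx, rfl, hxy⟩ := h
  obtain ⟨g, hg, rfl⟩ := proj_eq_iff.1 hx
  refine ⟨g⁻¹ y, proj_eq_iff.2 ⟨g⁻¹, inv_mem hg, rfl⟩, ?_⟩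
  have := hxy.symm.map g⁻¹
  rwa [map_sub, ← AlgEquiv.mul_apply g⁻¹ g, inv_mul_cancel, AlgEquiv.one_apply] at this

theorem orbitClose_antitone (n : ℕ) : Antitone (orbitClose f n) := by
  rintro M N hMN a ⟨x, y, hx, hy, hxy⟩
  exact ⟨x, y, hx, hy, hxy.mono (by exact_mod_cast hMN)⟩

theorem hasBasis_orbitClose (n : ℕ) :
    (⨅ N, Filter.principal (orbitClose f n N)).HasBasis (fun _ : ℕ => True) (orbitClose f n) :=
  Filter.hasBasis_iInf_principal (orbitClose_antitone n).directed_ge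

/-- The uniform structure of the orbit space. -/
@[reducible]
def orbitCore (f : Type*) [Field f] (n : ℕ) : UniformSpace.Core (OrbitSpace f n) :=
  UniformSpace.Core.mk' (⨅ N, Filter.principal (orbitClose f n N))
    (fun r hr a => by
      obtain ⟨N, -, hN⟩ := (hasBasis_orbitClose n).mem_iff.1 hr
      obtain ⟨x, rfl⟩ := proj_surjective n a
      exact hN ⟨x, x, rfl, rfl, by rw [sub_self]; exact OrdGE.zero _⟩)
    (fun r hr => by
      obtain ⟨N, -, hN⟩ := (hasBasis_orbitClose n).mem_iff.1 hr
      refine (hasBasis_orbitClose n).mem_iff.2 ⟨N, trivial, ?_⟩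
      rintro ⟨a, b⟩ ⟨x, y, hx, hy, hxy⟩
      exact hN ⟨y, x, hy, hx, hxy.symm⟩)
    (fun r hr => by
      obtain ⟨N, -, hN⟩ := (hasBasis_orbitClose n).mem_iff.1 hr
      refine ⟨_, (hasBasis_orbitClose n).mem_of_mem (i := N) trivial, ?_⟩
      rintro ⟨a, c⟩ ⟨b, hab, hbc⟩
      obtain ⟨x, rfl⟩ := proj_surjective n a
      obtain ⟨y, rfl, hxy⟩ := orbitClose.exists_rep hab
      obtain ⟨z, rfl, hyz⟩ := orbitClose.exists_rep hbc
      exact hN ⟨x, z, rfl, rfl, (hyz.trans hxy).symm⟩)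

theorem nhds_eq_comap_orbitCore (n : ℕ) (a : OrbitSpace f n) :
    nhds a = Filter.comap (Prod.mk a) (orbitCore f n).uniformity := by
  obtain ⟨x, rfl⟩ := proj_surjective n a
  refine (hasBasis_nhds_proj n x).eq_of_same_basis ?_
  convert! (hasBasis_orbitClose n).comap (Prod.mk (proj f n x)) using 1
  funext N
  ext b
  constructor
  · rintro ⟨y, hy, rfl⟩
    exact ⟨x, y, rfl, rfl, OrdGE.symm hy⟩
  · intro h
    obtain ⟨y, rfl, hy⟩ := orbitClose.exists_rep h
    exact ⟨y, hy, rfl⟩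

theorem isCompletelyMetrizableSpace_orbitSpace (n : ℕ) :
    TopologicalSpace.IsCompletelyMetrizableSpace (OrbitSpace f n) := by
  let _ : UniformSpace (OrbitSpace f n) :=
    { orbitCore f n with
      toTopologicalSpace := inferInstance
      nhds_eq_comap_uniformity := nhds_eq_comap_orbitCore n }
  have hb : (uniformity (OrbitSpace f n)).HasBasis (fun _ : ℕ => True) (orbitClose f n) :=
    hasBasis_orbitClose n
  have : (uniformity (OrbitSpace f n)).IsCountablyGenerated := hb.isCountablyGenerated
  have : CompleteSpace (OrbitSpace f n) := by
    -- A controlled sequence of orbits lifts, one representative at a time, to a Cauchy sequence in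
    -- `F`, whose limit is then projected.
    refine UniformSpace.complete_of_convergent_controlled_sequences (orbitClose f n)
      (fun N => hb.mem_of_mem trivial) fun u hu => ?_
    have step : ∀ (k : ℕ) (x : f⸨X⸩), ∃ y, proj f n x = u k →
        proj f n y = u (k + 1) ∧ OrdGE k (y - x) := by
      intro k x
      by_cases hx : proj f n x = u k
      · obtain ⟨y, hy⟩ := orbitClose.exists_rep (hx ▸ hu k k (k + 1) le_rfl (by omega))
        exact ⟨y, fun _ => hy⟩
      · exact ⟨x, fun h => absurd h hx⟩
    choose F hF using step
    obtain ⟨x₀, hx₀⟩ := proj_surjective n (u 0)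
    let s : ℕ → f⸨X⸩ := fun k => Nat.rec x₀ F k
    have hs : ∀ k, proj f n (s k) = u k := by
      intro k
      induction k with
      | zero => exact hx₀
      | succ k ih => exact (hF k _ ih).1
    obtain ⟨z, hz⟩ := exists_limit s 0 fun k => ((hF k _ (hs k)).2).mono (by simp)
    refine ⟨proj f n z, ?_⟩
    have hlim : Filter.Tendsto s Filter.atTop (nhds z) := by
      refine (Filter.atTop_basis.tendsto_iff (hasBasis_nhds z)).2 fun N _ => ⟨N, trivial, ?_⟩
      intro k hk
      exact (hz k).symm.mono (by rw [zero_add]; exact_mod_cast hk)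
    exact (((isOpenQuotientMap_proj n).continuous.tendsto z).comp hlim).congr hs
  have := TopologicalSpace.IsCompletelyPseudoMetrizableSpace.of_completeSpace_pseudometrizable
    (X := OrbitSpace f n)
  exact TopologicalSpace.IsCompletelyMetrizableSpace_of_isCompletelyPseudoMetrizableSpace

/-! ### Closedness of the projection -/

theorem isClosed_image_proj_iff {n : ℕ} {A : Set f⸨X⸩} : IsClosed (proj f n '' A) ↔
    ∀ y, (∀ N : ℕ, ∃ a ∈ A, ∃ g ∈ G f n, OrdGE N (g a - y)) → ∃ a ∈ A, ∃ g ∈ G f n, g a = y := by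
  rw [← (isOpenQuotientMap_proj n).isQuotientMap.isClosed_preimage, isClosed_iff]
  have hmem : ∀ y, y ∈ proj f n ⁻¹' (proj f n '' A) ↔ ∃ a ∈ A, ∃ g ∈ G f n, g a = y := by
    intro y
    simp only [Set.mem_preimage, Set.mem_image]
    exact exists_congr fun a => and_congr_right fun _ => by rw [eq_comm, proj_eq_iff]
  refine forall_congr' fun y => ?_
  rw [hmem]
  refine imp_congr_left (forall_congr' fun N => ⟨?_, ?_⟩)
  · rintro ⟨z, hz, hzy⟩
    obtain ⟨a, ha, g, hg, rfl⟩ := (hmem z).1 hz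
    exact ⟨a, ha, g, hg, hzy⟩
  · rintro ⟨a, ha, g, hg, h⟩
    exact ⟨g a, (hmem _).2 ⟨a, ha, g, hg, rfl⟩, h⟩

/-- A nonconstant `y` has an open orbit, which already contains some approximant. A constant is
fixed by every `g`, so the approximants can be pulled back into `A`. -/
theorem isClosedMap_proj_of_charZero [CharP f 0] (n : ℕ) : IsClosedMap (proj f n) := by
  intro A hA
  refine isClosed_image_proj_iff.2 fun y hy => ?_
  by_cases hc : y ∈ powSeries f 0
  · obtain ⟨c, rfl⟩ := mem_powSeries_zero_iff.1 hc
    refine ⟨_, isClosed_iff.1 hA _ fun N => ?_, 1, one_mem _, rfl⟩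
    obtain ⟨a, ha, g, -, h⟩ := hy N
    have := h.map g.symm
    rw [map_sub, g.symm_apply_apply, g.symm.commutes] at this
    exact ⟨a, ha, this⟩
  · obtain ⟨B, hB⟩ := exists_mem_G_map_eq (derivative_ne_zero 0 hc) n
    obtain ⟨a, ha, g, hg, h⟩ := hy B
    obtain ⟨r, hr, e⟩ := hB _ h
    exact ⟨a, ha, r⁻¹ * g, mul_mem (inv_mem hr) hg, by
      rw [AlgEquiv.mul_apply, ← e, ← AlgEquiv.mul_apply, inv_mul_cancel, AlgEquiv.one_apply]⟩

/-- Over a finite field, balls are compact. -/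
theorem isCompact_ordGE [Finite f] (m : ℤ) : IsCompact {x : f⸨X⸩ | OrdGE m x} := by
  let _ : TopologicalSpace f := ⊥
  have : DiscreteTopology f := ⟨rfl⟩
  -- The ball is a continuous image of the compact product of copies of the finite discrete space
  -- `f`.
  let Φ : (ℕ → f) → f⸨X⸩ := fun a =>
    HahnSeries.single m 1 * ((PowerSeries.mk a : PowerSeries f) : f⸨X⸩)
  have hΦ : Continuous Φ := by
    refine continuous_iff_continuousAt.2 fun a => ?_
    refine (hasBasis_nhds (Φ a)).tendsto_right_iff.2 fun N _ => ?_
    have hev : ∀ᶠ b in nhds a, ∀ i ∈ Set.Iio (N + (-m).toNat), b i = a i := by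
      rw [Filter.eventually_all_finite (Set.finite_Iio _)]
      intro i _
      exact (continuous_apply i : Continuous fun b : ℕ → f => b i).continuousAt.eventually_mem
        (s := {a i}) (mem_nhds_discrete.2 rfl)
    filter_upwards [hev] with b hb
    have h1 : OrdGE (N + (-m).toNat : ℕ) (((PowerSeries.mk b : PowerSeries f) : f⸨X⸩) -
        ((PowerSeries.mk a : PowerSeries f) : f⸨X⸩)) := by
      intro i hi
      rw [HahnSeries.coeff_sub, PowerSeries.coeff_coe, PowerSeries.coeff_coe]
      split_ifs
      · simp
      · rw [PowerSeries.coeff_mk, PowerSeries.coeff_mk, hb _ (by simp; omega), sub_self]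
    have h2 := (ordGE_single (le_refl m) (1 : f)).mul h1
    rw [mul_sub] at h2
    exact h2.mono (by push_cast; omega)
  convert! isCompact_range hΦ
  ext x
  constructor
  · intro hx
    have hs : (HahnSeries.single m (1 : f)).orderTop = m := HahnSeries.orderTop_single one_ne_zero
    have hs0 : HahnSeries.single m (1 : f) ≠ 0 := by simp
    have h0 : OrdGE 0 ((HahnSeries.single m (1 : f))⁻¹ * x) := by
      have : OrdGE m (HahnSeries.single m (1 : f) * ((HahnSeries.single m (1 : f))⁻¹ * x)) := by
        rwa [mul_inv_cancel_left₀ hs0]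
      simpa using this.of_mul_left hs
    obtain ⟨P, hP⟩ := exists_powerSeries (ordGE_zero_iff.1 h0)
    refine ⟨fun i => PowerSeries.coeff i P, ?_⟩
    have : PowerSeries.mk (fun i => PowerSeries.coeff i P) = P := by ext i; simp
    simp only [Φ, this, ← hP]
    rw [mul_inv_cancel_left₀ hs0]
  · rintro ⟨a, rfl⟩
    exact ((ordGE_single (le_refl m) (1 : f)).mul
      (ordGE_zero_iff.2 (orderTop_powerSeries _))).mono (by simp)

/-- The orbit of `y` is closed in a compact ball. If it missed the closed set `A`, finitely many
balls avoiding `A` would cover it, and their largest index gives a precision at which no `g a` can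
approximate `y`. -/
theorem isClosedMap_proj_of_finite [Finite f] (n : ℕ) : IsClosedMap (proj f n) := by
  intro A hA
  refine isClosed_image_proj_iff.2 fun y hy => ?_
  by_contra! hcon
  obtain ⟨m, hm⟩ := exists_ordGE y
  have hK : IsCompact (MulAction.orbit (G f n) y) := by
    refine (isCompact_ordGE m).of_isClosed_subset (isClosed_orbit (ringChar f) n y) fun x hx => ?_
    obtain ⟨g, -, rfl⟩ := mem_orbit_iff.1 hx
    exact hm.map g
  have hd : ∀ x ∈ MulAction.orbit (G f n) y, x ∈ Aᶜ := by
    intro x hx hxA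
    obtain ⟨g, hg, rfl⟩ := mem_orbit_iff.1 hx
    exact hcon _ hxA g⁻¹ (inv_mem hg) (g.symm_apply_apply y)
  choose! N hN using fun x hx => isOpen_iff.1 hA.isOpen_compl x (hd x hx)
  obtain ⟨T, hT, hcov⟩ := hK.elim_nhds_subcover (fun x => {z | OrdGE (N x) (z - x)})
    fun x _ => (hasBasis_nhds x).mem_of_mem trivial
  obtain ⟨a, ha, g, hg, hga⟩ := hy (T.sup N)
  have hx := hcov (mem_orbit_iff.2 ⟨g⁻¹, inv_mem hg, rfl⟩)
  simp only [Set.mem_iUnion] at hx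
  obtain ⟨x, hxT, hx⟩ := hx
  refine hN x (hT x hxT) a ?_ ha
  have h1 := hga.map g⁻¹
  rw [map_sub, ← AlgEquiv.mul_apply g⁻¹ g, inv_mul_cancel, AlgEquiv.one_apply] at h1
  exact (h1.mono (by exact_mod_cast Finset.le_sup hxT)).trans hx

/-- For distinct `c k`, put `g k t = t + c k t ^ (n + 2)` and `a k = (g k t) ^ p + t ^ (e k)`, with
`e k` prime to `p` and tending to infinity. The coefficients `c k ^ p` in degree `p (n + 2)` are
distinct, so the `a k` form a closed set. Yet `(g k)⁻¹ (a k)` tends to `t ^ p`, whose orbit contains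
no `a k`, since `a k ∉ f((t ^ p))`. -/
theorem finite_of_isClosedMap_proj {p : ℕ} [CharP f p] (hp : p.Prime) (n : ℕ)
    (H : IsClosedMap (proj f n)) : Finite f := by
  by_contra hinf
  rw [not_finite_iff_infinite] at hinf
  have hq : AddPow f p := addPow_prime hp
  have hp1 : (1 : ℤ) < p := by exact_mod_cast hp.one_lt
  let c := Infinite.natEmbedding f
  have hex : ∀ k, ∃ g : f⸨X⸩ ≃ₐ[f] f⸨X⸩,
      g (tvar f) = tvar f + HahnSeries.single ((n : ℤ) + 2) (c k) := fun k =>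
    exists_algEquiv _ (by rw [add_sub_cancel_left]; exact ordGE_single (by omega) _)
  choose g hg using hex
  have hgG : ∀ k, g k ∈ G f n := fun k => by
    rw [mem_G_iff, hg, add_sub_cancel_left]
    exact ordGE_single (by omega) _
  let e : ℕ → ℤ := fun k => p * (n + 2 + k) + 1
  have he : ∀ k, ¬ (p : ℤ) ∣ e k := fun k h => by
    have h1 : (p : ℤ) ∣ 1 := (Int.dvd_add_right (dvd_mul_right _ _)).1 h
    have := Int.le_of_dvd one_pos h1
    omega
  have hek : ∀ k : ℕ, p * ((n : ℤ) + 2) < e k ∧ (k : ℤ) ≤ e k := fun k => by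
    simp only [e]
    constructor <;> nlinarith
  let a : ℕ → f⸨X⸩ := fun k => g k (tvar f) ^ p + HahnSeries.single (e k) 1
  have ha1 : ∀ k, (a k).coeff (p * ((n : ℤ) + 2)) = c k ^ p := fun k => by
    simp only [a, HahnSeries.coeff_add, hq.coeff_pow, hg]
    rw [HahnSeries.coeff_single_of_ne (hek k).1.ne, HahnSeries.coeff_single_same, tvar,
      HahnSeries.coeff_single_of_ne (by omega), zero_add, add_zero]
  have ha2 : ∀ k, a k ∉ powSeries f p := fun k hk => he k (hk _ (by
    simp only [a, HahnSeries.coeff_add, HahnSeries.coeff_single_same]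
    rw [not_imp_comm.1 (hq.pow_mem_powSeries _ (e k)) (he k), zero_add]
    exact one_ne_zero))
  have hA : IsClosed (Set.range a) := by
    refine isClosed_iff.2 fun x hx => ?_
    have hx' : ∀ N : ℕ, ∃ k, OrdGE N (a k - x) := fun N => by
      obtain ⟨_, ⟨k, rfl⟩, h⟩ := hx N
      exact ⟨k, h⟩
    have hc : ∀ N k, p * (n + 2) < N → OrdGE (N : ℕ) (a k - x) →
        c k ^ p = x.coeff (p * ((n : ℤ) + 2)) := fun N k hN h => by
      have := h (p * ((n : ℤ) + 2)) (by exact_mod_cast hN)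
      rwa [HahnSeries.coeff_sub, ha1, sub_eq_zero] at this
    obtain ⟨k₀, hk₀⟩ := hx' (p * (n + 2) + 1)
    refine ⟨k₀, sub_eq_zero.1 (eq_zero_of_forall_ordGE fun N => ?_)⟩
    obtain ⟨k, hk⟩ := hx' (p * (n + 2) + 1 + N)
    have hcc : c k = c k₀ := hq.frob.injective
      ((hc _ _ (by omega) hk).trans (hc _ _ (by omega) hk₀).symm)
    rw [c.injective hcc] at hk
    exact hk.mono (by omega)
  obtain ⟨_, ⟨k, rfl⟩, r, -, hr⟩ := isClosed_image_proj_iff.1 (H _ hA) (tvar f ^ p) fun N => by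
    refine ⟨a N, ⟨N, rfl⟩, (g N)⁻¹, inv_mem (hgG N), ?_⟩
    have h1 : (g N)⁻¹ (a N) - tvar f ^ p = (g N)⁻¹ (HahnSeries.single (e N) 1) := by
      simp only [a]
      rw [← map_pow, map_add, ← AlgEquiv.mul_apply, inv_mul_cancel, AlgEquiv.one_apply,
        add_sub_cancel_left]
    rw [h1]
    exact (ordGE_single (hek N).2 1).map _
  refine ha2 k ?_
  have : r.symm (tvar f ^ p) = a k := by rw [← hr, r.symm_apply_apply]
  rw [← this]
  exact hq.map_mem_powSeries _ (hq.pow_mem_powSeries _)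

end FormalSing

theorem theorem9 (f : Type*) [Field f] (p : ℕ) [CharP f p] (n : ℕ) :
    -- the orbit of `h` is open iff `h ∈ F \ f((t ^ p))`
    (∀ h : f⸨X⸩, IsOpen (MulAction.orbit (FormalSing.G f n) h) ↔
      h ∉ FormalSing.powSeries f p) ∧
    -- for nonconstant `h ∈ f((t ^ (p ^ m))) \ f((t ^ (p ^ (m + 1))))`, the orbit of `h` is open in
    -- the relative topology of `f((t ^ (p ^ m)))`; this holds for all such `h` iff `f` is perfect
    ((∀ h : f⸨X⸩, h ∉ Set.range (algebraMap f f⸨X⸩) → ∀ m : ℕ,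
        h ∈ FormalSing.powSeries f (p ^ m) \ FormalSing.powSeries f (p ^ (m + 1)) →
        IsOpen ((↑) ⁻¹' MulAction.orbit (FormalSing.G f n) h :
          Set (FormalSing.powSeries f (p ^ m)))) ↔
      PerfectField f) ∧
    -- polynomial normal forms
    (∀ h : f⸨X⸩, h ∉ FormalSing.powSeries f p →
      (MulAction.orbit (FormalSing.G f n) h ∩ FormalSing.laurentPoly f).Nonempty) ∧
    ((∀ h : f⸨X⸩, (MulAction.orbit (FormalSing.G f n) h ∩ FormalSing.laurentPoly f).Nonempty) ↔
      PerfectField f) ∧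
    -- every orbit is closed
    (∀ h : f⸨X⸩, IsClosed (MulAction.orbit (FormalSing.G f n) h)) ∧
    -- the canonical projection onto the orbit space is a closed map iff `f` is finite or `p = 0`
    (IsClosedMap (FormalSing.proj f n) ↔ (Finite f ∨ p = 0)) ∧
    -- the quotient topology of the orbit space is induced by a complete metric
    TopologicalSpace.IsCompletelyMetrizableSpace (FormalSing.OrbitSpace f n) := by
  refine ⟨fun h => ⟨fun ho hh => FormalSing.not_isOpen_orbit p n hh ho,
    FormalSing.isOpen_orbit p n⟩, ⟨FormalSing.perfectField_of_isOpen p n,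
    fun _ h _ m hm => FormalSing.isOpen_orbit_relative p n hm⟩,
    fun h hh => FormalSing.orbit_inter_laurentPoly_nonempty p n hh,
    ⟨FormalSing.perfectField_of_laurentPoly p n,
      fun _ h => FormalSing.exists_laurentPoly_of_perfectField p n h⟩,
    FormalSing.isClosed_orbit p n, ⟨fun H => ?_, ?_⟩,
    FormalSing.isCompletelyMetrizableSpace_orbitSpace n⟩
  · rcases CharP.char_is_prime_or_zero f p with hp | hp
    · exact Or.inl (FormalSing.finite_of_isClosedMap_proj hp n H)
    · exact Or.inr hp
  · rintro (_ | rfl)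
    · exact FormalSing.isClosedMap_proj_of_finite n
    · exact FormalSing.isClosedMap_proj_of_charZero n
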